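/- Let $p$ be a prime. Let $B$ be an $\mathbb{F}_p$-algebra and $B'$ a flat $B$-algebra, and suppose that $B$ and $B'$ are perfect (i.e. the Frobenius $x\mapsto x^p$ is bijective). Let $C$ be a semiperfect $B$-algebra (i.e. the Frobenius of $C$ is surjective). Then the canonical ring homomorphism $$A_{\mathrm{cris}}(C)\,\hat\otimes_{W(B)}\,W(B')\longrightarrow A_{\mathrm{cris}}(C\otimes_B B')$$ is an isomorphism. Here $W$ denotes $p$-typical Witt vectors. For a semiperfect $\mathbb{F}_p$-algebra $C$, let $C^\flat$ be the ring of sequences $(c_0,c_1,\ldots)$ in $C$ with $c_{n+1}^p=c_n$ for all $n$; then $A_{\mathrm{cris}}(C)$ is the $p$-adic completion of the PD hull (divided power envelope) of the surjection $W(C^\flat)\twoheadrightarrow C^\flat\twoheadrightarrow C$, the second map being $(c_0,c_1,\ldots)\mapsto c_0$, where divided powers are required to satisfy $\gamma_m(p)=p^m/m!$. Since $B$ is perfect, $B\to C$ lifts uniquely to $B\to C^\flat$, which makes $A_{\mathrm{cris}}(C)$ a $W(B)$-algebra, and $\hat\otimes$ denotes the $p$-adic completion of the tensor product. The canonical map is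 the $p$-adically continuous extension of the map $A_{\mathrm{cris}}(C)\otimes_{W(B)}W(B')\to A_{\mathrm{cris}}(C\otimes_BB')$ induced by $C\to C\otimes_BB'$ and $B'\to C\otimes_BB'$. -/

import Mathlib

open scoped TensorProduct

noncomputable section

/-- `R` is an `𝔽_p`-algebra: a ring in which `p = 0`. The zero ring is allowed (it can occur as a
tensor product), which is why `CharP R p` is not used. -/
class IsFpAlgebra (p : ℕ) (R : Type*) [CommRing R] : Prop where
  natCast_eq_zero : (p : R) = 0

/-- A semiperfect `𝔽_p`-algebra: the Frobenius `x ↦ x ^ p` is surjective. (Perfectness, i.e.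
bijectivity of the Frobenius, is Mathlib's `PerfectRing R p`.) -/
class IsSemiperfect (p : ℕ) (R : Type*) [CommRing R] : Prop where
  surjective_frobenius : Function.Surjective fun x : R => x ^ p

instance IsFpAlgebra.tensorProduct (p : ℕ) (B C B' : Type*) [CommRing B] [CommRing C]
    [CommRing B'] [Algebra B C] [Algebra B B'] [IsFpAlgebra p C] :
    IsFpAlgebra p (C ⊗[B] B') where
  natCast_eq_zero := by
    have h := map_natCast (algebraMap C (C ⊗[B] B')) p
    rw [← h, IsFpAlgebra.natCast_eq_zero, map_zero]

/-! ### The Frobenius and the Fontainization `C♭` -/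

section Fontainization

variable (p : ℕ) [Fact p.Prime]

theorem IsFpAlgebra.add_pow {R : Type*} [CommRing R] [IsFpAlgebra p R] (x y : R) :
    (x + y) ^ p = x ^ p + y ^ p := by
  obtain ⟨r, hr⟩ := exists_add_pow_prime_eq (Fact.out : p.Prime) x y
  rw [hr, IsFpAlgebra.natCast_eq_zero (p := p) (R := R)]
  ring

/-- The Frobenius automorphism `x ↦ x ^ p` of a perfect `𝔽_p`-algebra. -/
def perfectFrobenius (R : Type*) [CommRing R] [IsFpAlgebra p R] [PerfectRing R p] : RingAut R :=
  RingEquiv.ofBijective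
    ({ toFun := fun x => x ^ p
       map_one' := one_pow p
       map_mul' := fun x y => mul_pow x y p
       map_zero' := zero_pow (Fact.out : p.Prime).ne_zero
       map_add' := IsFpAlgebra.add_pow p } : R →+* R)
    PerfectRing.bijective_frobenius

theorem perfectFrobenius_apply {R : Type*} [CommRing R] [IsFpAlgebra p R] [PerfectRing R p]
    (x : R) : perfectFrobenius p R x = x ^ p := rfl

/-- The Fontainization `C♭` as a subring of `ℕ → C`: the sequences `(c₀, c₁, …)` such that
`c_{n+1} ^ p = c_n` for all `n`. -/
def fontainization (C : Type*) [CommRing C] [IsFpAlgebra p C] : Subring (ℕ → C) where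
  carrier := {c | ∀ n, c (n + 1) ^ p = c n}
  mul_mem' {a b} ha hb n := by simp only [Pi.mul_apply, mul_pow, ha n, hb n]
  one_mem' n := one_pow p
  add_mem' {a b} ha hb n := by simp only [Pi.add_apply, IsFpAlgebra.add_pow p, ha n, hb n]
  zero_mem' n := zero_pow (Fact.out : p.Prime).ne_zero
  neg_mem' {a} ha n := by
    have h := IsFpAlgebra.add_pow p (a (n + 1)) (-a (n + 1))
    rw [add_neg_cancel, zero_pow (Fact.out : p.Prime).ne_zero, ha n] at h
    exact (neg_eq_of_add_eq_zero_right h.symm).symm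

/-- The Fontainization `C♭ = lim (⋯ → C → C)` along the Frobenius of `C`. -/
abbrev Fontainization (C : Type*) [CommRing C] [IsFpAlgebra p C] := ↥(fontainization p C)

namespace Fontainization

/-- The projection `ν_n : C♭ → C`, `(c₀, c₁, …) ↦ c_n`. -/
def proj (C : Type*) [CommRing C] [IsFpAlgebra p C] (n : ℕ) : Fontainization p C →+* C :=
  (Pi.evalRingHom (fun _ : ℕ => C) n).comp (fontainization p C).subtype

/-- Functoriality of the Fontainization. -/
def map {C D : Type*} [CommRing C] [CommRing D] [IsFpAlgebra p C] [IsFpAlgebra p D]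
    (f : C →+* D) : Fontainization p C →+* Fontainization p D where
  toFun c := ⟨fun n => f (c.1 n), fun n => by rw [← map_pow, c.2 n]⟩
  map_one' := by ext n; exact map_one f
  map_mul' a b := by ext n; exact map_mul f _ _
  map_zero' := by ext n; exact map_zero f
  map_add' a b := by ext n; exact map_add f _ _

/-- A homomorphism `φ : B → C` from a perfect `𝔽_p`-algebra `B` lifts to `B → C♭`,
`b ↦ (φ b, φ (b^{1/p}), φ (b^{1/p²}), …)`. -/
def lift {B C : Type*} [CommRing B] [CommRing C] [IsFpAlgebra p B] [IsFpAlgebra p C]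
    [PerfectRing B p] (φ : B →+* C) : B →+* Fontainization p C where
  toFun b := ⟨fun n => φ (((perfectFrobenius p B)⁻¹ ^ n) b), fun n => by
    rw [← map_pow, ← perfectFrobenius_apply, ← RingAut.mul_apply, pow_succ', mul_inv_cancel_left]⟩
  map_one' := by ext n; exact (congrArg φ (map_one _)).trans (map_one φ)
  map_mul' a b := by ext n; exact (congrArg φ (map_mul _ a b)).trans (map_mul φ _ _)
  map_zero' := by ext n; exact (congrArg φ (map_zero _)).trans (map_zero φ)
  map_add' a b := by ext n; exact (congrArg φ (map_add _ a b)).trans (map_add φ _ _)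

theorem map_comp_lift {B C D : Type*} [CommRing B] [CommRing C] [CommRing D] [IsFpAlgebra p B]
    [IsFpAlgebra p C] [IsFpAlgebra p D] [PerfectRing B p] (f : C →+* D) (φ : B →+* C) :
    (map p f).comp (lift p φ) = lift p (f.comp φ) := rfl

theorem lift_comp {B B' C : Type*} [CommRing B] [CommRing B'] [CommRing C] [IsFpAlgebra p B]
    [IsFpAlgebra p B'] [IsFpAlgebra p C] [PerfectRing B p] [PerfectRing B' p]
    (φ : B' →+* C) (ψ : B →+* B') :
    (lift p φ).comp ψ = lift p (φ.comp ψ) := by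
  have key : ∀ b, (perfectFrobenius p B')⁻¹ (ψ b) = ψ ((perfectFrobenius p B)⁻¹ b) := fun b => by
    apply (perfectFrobenius p B').injective
    rw [← RingAut.mul_apply, mul_inv_cancel, RingAut.one_apply, perfectFrobenius_apply,
      ← map_pow, ← perfectFrobenius_apply, ← RingAut.mul_apply, mul_inv_cancel, RingAut.one_apply]
  have key' : ∀ (n : ℕ) (b : B),
      ((perfectFrobenius p B')⁻¹ ^ n) (ψ b) = ψ (((perfectFrobenius p B)⁻¹ ^ n) b) := by
    intro n
    induction n with
    | zero => intro b; rfl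
    | succ n ih =>
      intro b
      rw [pow_succ', pow_succ', RingAut.mul_apply, RingAut.mul_apply, ih, key]
  ext b n
  exact congrArg φ (key' n b)

end Fontainization

end Fontainization

/-! ### PD hulls -/

section PDHull

variable (p : ℕ)

/-- The ideal of the divided power algebra `Γ_A(I)` of the `A`-module `I` that is generated by
`x^{[1]} - x` for `x ∈ I` and, if `p ∈ I`, by `p^{[m]} - p^m/m!` for `m ∈ ℕ`. The latter relation
is written without division: if `p^m/m! = a/b` in lowest terms (`b` is then prime to `p`), then it
is `b * p^{[m]} - a`. -/
def pdHullIdeal {A : Type*} [CommRing A] (I : Ideal A) : Ideal (DividedPowerAlgebra A I) :=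
  Ideal.span
    ({z | ∃ x : I, z = DividedPowerAlgebra.dp A 1 x - algebraMap A _ (x : A)} ∪
      {z | ∃ (h : (p : A) ∈ I) (m : ℕ),
        z = ((((p : ℚ) ^ m / (m.factorial : ℚ)).den : ℕ) : DividedPowerAlgebra A I) *
              DividedPowerAlgebra.dp A m (⟨(p : A), h⟩ : I) -
            ((((p : ℚ) ^ m / (m.factorial : ℚ)).num : ℤ) : DividedPowerAlgebra A I)})

/-- The PD hull of `A ↠ A/I`, where `A` is a `ℤ_(p)`-algebra and `p ∈ I`, with PD structures
required to satisfy `γ_m(p) = p^m/m!`. This is the usual construction (Berthelot, Berthelot-Ogus)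
as the quotient of the divided power algebra `Γ_A(I)` by the ideal generated by the elements
`x^{[1]} - x` (`x ∈ I`) and `p^{[m]} - p^m/m!`; the PD ideal is the image of the augmentation ideal
of `Γ_A(I)`, and `γ_m(x)` is the class of `x^{[m]}` for `x ∈ I`. -/
def PDHull {A : Type*} [CommRing A] (I : Ideal A) := DividedPowerAlgebra A I ⧸ pdHullIdeal p I

namespace PDHull

instance {A : Type*} [CommRing A] (I : Ideal A) : CommRing (PDHull p I) :=
  inferInstanceAs (CommRing (DividedPowerAlgebra A I ⧸ pdHullIdeal p I))

/-- The canonical homomorphism from `A` to the PD hull. -/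
def of {A : Type*} [CommRing A] (I : Ideal A) : A →+* PDHull p I :=
  (Ideal.Quotient.mk (pdHullIdeal p I)).comp (algebraMap A (DividedPowerAlgebra A I))

/-- The divided power `γ_m(x)`, `x ∈ I`, as an element of the PD hull. -/
def gamma {A : Type*} [CommRing A] (I : Ideal A) (m : ℕ) (x : I) : PDHull p I :=
  Ideal.Quotient.mk (pdHullIdeal p I) (DividedPowerAlgebra.dp A m x)

theorem gamma_one {A : Type*} [CommRing A] (I : Ideal A) (x : I) :
    gamma p I 1 x = of p I (x : A) :=
  Ideal.Quotient.eq.mpr (Ideal.subset_span (Or.inl ⟨x, rfl⟩))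

section Map

variable {A A' : Type*} [CommRing A] [CommRing A'] {I : Ideal A} {I' : Ideal A'}
  (f : A →+* A') (hf : ∀ x ∈ I, f x ∈ I')

/-- The homomorphism `Γ_A(I) → Γ_{A'}(I')`, `x^{[m]} ↦ f(x)^{[m]}`, given by a homomorphism
`f : A → A'` with `f(I) ⊆ I'`. -/
def mapAux : DividedPowerAlgebra A I →+* DividedPowerAlgebra A' I' :=
  letI : Algebra A (DividedPowerAlgebra A' I') :=
    ((algebraMap A' (DividedPowerAlgebra A' I')).comp f).toAlgebra
  (DividedPowerAlgebra.lift' (R := A) (M := I) (A := DividedPowerAlgebra A' I')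
    (f := fun nx => DividedPowerAlgebra.dp A' nx.1 (⟨f nx.2, hf _ nx.2.2⟩ : I'))
    (fun _ => DividedPowerAlgebra.dp_zero)
    (fun n r m => by
      have h : (⟨f ((r • m : I) : A), hf _ (r • m : I).2⟩ : I') = f r • ⟨f (m : A), hf _ m.2⟩ :=
        Subtype.ext (map_mul f r (m : A))
      dsimp only
      rw [h, DividedPowerAlgebra.dp_smul, Algebra.smul_def, Algebra.smul_def, map_pow, map_pow]
      rfl)
    (fun _ _ _ => DividedPowerAlgebra.dp_mul)
    (fun n u v => by
      have h : (⟨f ((u + v : I) : A), hf _ (u + v : I).2⟩ : I') =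
          ⟨f (u : A), hf _ u.2⟩ + ⟨f (v : A), hf _ v.2⟩ :=
        Subtype.ext (map_add f (u : A) (v : A))
      dsimp only
      rw [h, DividedPowerAlgebra.dp_add])).toRingHom

theorem mapAux_dp (m : ℕ) (x : I) :
    mapAux f hf (DividedPowerAlgebra.dp A m x) =
      DividedPowerAlgebra.dp A' m (⟨f x, hf _ x.2⟩ : I') := by
  let _ : Algebra A (DividedPowerAlgebra A' I') :=
    ((algebraMap A' (DividedPowerAlgebra A' I')).comp f).toAlgebra
  exact DividedPowerAlgebra.lift'_apply_dp (R := A) (M := I) _ _ _ _ m x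

theorem mapAux_algebraMap (a : A) :
    mapAux f hf (algebraMap A _ a) = algebraMap A' _ (f a) := by
  let _ : Algebra A (DividedPowerAlgebra A' I') :=
    ((algebraMap A' (DividedPowerAlgebra A' I')).comp f).toAlgebra
  exact AlgHom.commutes _ a

theorem mapAux_mem (z : DividedPowerAlgebra A I) (hz : z ∈ pdHullIdeal p I) :
    mapAux f hf z ∈ pdHullIdeal p I' := by
  suffices h : pdHullIdeal p I ≤ (pdHullIdeal p I').comap (mapAux f hf) from h hz
  refine Ideal.span_le.mpr ?_
  rintro z (⟨x, rfl⟩ | ⟨h, m, rfl⟩)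
  · refine Ideal.subset_span (Or.inl ⟨⟨f x, hf _ x.2⟩, ?_⟩)
    rw [map_sub, mapAux_dp, mapAux_algebraMap]
  · have h' : (p : A') ∈ I' := by simpa using hf _ h
    refine Ideal.subset_span (Or.inr ⟨h', m, ?_⟩)
    rw [map_sub, map_mul, map_natCast, map_intCast, mapAux_dp]
    congr 4
    exact map_natCast f p

/-- Functoriality of the PD hull. -/
def map : PDHull p I →+* PDHull p I' :=
  Ideal.quotientMap (pdHullIdeal p I') (mapAux f hf) (fun z hz => mapAux_mem p f hf z hz)

theorem map_of (a : A) : map p f hf (of p I a) = of p I' (f a) :=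
  congrArg (Ideal.Quotient.mk _) (mapAux_algebraMap f hf a)

theorem map_gamma (m : ℕ) (x : I) :
    map p f hf (gamma p I m x) = gamma p I' m ⟨f x, hf _ x.2⟩ :=
  congrArg (Ideal.Quotient.mk _) (mapAux_dp f hf m x)

end Map

end PDHull

end PDHull

/-! ### `p`-adic completion -/

section PCompletion

variable (p : ℕ)

/-- The `p`-adic completion `lim R/p^n R` of a ring `R`. -/
abbrev PCompletion (R : Type*) [CommRing R] := AdicCompletion (Ideal.span {(p : R)}) R

namespace PCompletion

/-- The canonical homomorphism from `R` to its `p`-adic completion. -/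
abbrev of (R : Type*) [CommRing R] : R →+* PCompletion p R := algebraMap R (PCompletion p R)

variable {R S : Type*} [CommRing R] [CommRing S]

theorem factorPow_evalₐ (I : Ideal R) {m n : ℕ} (hle : m ≤ n) (x : AdicCompletion I R) :
    Ideal.Quotient.factorPow I hle (AdicCompletion.evalₐ I n x) = AdicCompletion.evalₐ I m x := by
  induction x using AdicCompletion.induction_on with
  | _ a =>
    rw [AdicCompletion.evalₐ_mk, AdicCompletion.evalₐ_mk]
    exact AdicCompletion.Ideal.mk_eq_mk I hle a

/-- The homomorphism `R/p^n R → S/p^n S` induced by `g : R → lim S/p^n S`. -/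
def liftAux (g : R →+* PCompletion p S) (n : ℕ) :
    R ⧸ Ideal.span {(p : R)} ^ n →+* S ⧸ Ideal.span {(p : S)} ^ n :=
  Ideal.Quotient.lift _
    (((AdicCompletion.evalₐ (Ideal.span {(p : S)}) n : _ →+* _)).comp g) (by
      intro a ha
      rw [Ideal.span_singleton_pow, Ideal.mem_span_singleton'] at ha
      obtain ⟨b, rfl⟩ := ha
      have h0 : ((p : S ⧸ Ideal.span {(p : S)} ^ n)) ^ n = 0 := by
        rw [← map_natCast (Ideal.Quotient.mk (Ideal.span {(p : S)} ^ n)), ← map_pow]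
        exact Ideal.Quotient.eq_zero_iff_mem.mpr
          (Ideal.pow_mem_pow (Ideal.mem_span_singleton_self _) n)
      rw [map_mul, map_pow, map_natCast, h0, mul_zero])

theorem factorPow_comp_liftAux (g : R →+* PCompletion p S) {m n : ℕ} (hle : m ≤ n) :
    (Ideal.Quotient.factorPow (Ideal.span {(p : S)}) hle).comp
        ((liftAux p g n).comp (AdicCompletion.evalₐ (Ideal.span {(p : R)}) n).toRingHom) =
      (liftAux p g m).comp (AdicCompletion.evalₐ (Ideal.span {(p : R)}) m).toRingHom := by
  ext x
  obtain ⟨a, ha⟩ := Ideal.Quotient.mk_surjective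
    (AdicCompletion.evalₐ (Ideal.span {(p : R)}) n x)
  have hm : AdicCompletion.evalₐ (Ideal.span {(p : R)}) m x = Ideal.Quotient.mk _ a := by
    rw [← factorPow_evalₐ _ hle, ← ha]
    rfl
  change Ideal.Quotient.factorPow _ hle
    (liftAux p g n (AdicCompletion.evalₐ (Ideal.span {(p : R)}) n x)) =
      liftAux p g m (AdicCompletion.evalₐ (Ideal.span {(p : R)}) m x)
  rw [← ha, hm]
  exact factorPow_evalₐ _ hle (g a)

/-- The unique `p`-adically continuous extension to the `p`-adic completion of `R` of a homomorphism
from `R` to the `p`-adic completion of `S`. -/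
def lift (g : R →+* PCompletion p S) : PCompletion p R →+* PCompletion p S :=
  AdicCompletion.liftRingHom (Ideal.span {(p : S)})
    (fun n => (liftAux p g n).comp (AdicCompletion.evalₐ (Ideal.span {(p : R)}) n).toRingHom)
    (factorPow_comp_liftAux p g)

theorem lift_of (g : R →+* PCompletion p S) (r : R) : lift p g (of p R r) = g r := by
  refine AdicCompletion.ext_evalₐ fun n => ?_
  refine (AdicCompletion.evalₐ_liftRingHom _ _ (factorPow_comp_liftAux p g) n _).trans ?_
  change liftAux p g n (AdicCompletion.evalₐ (Ideal.span {(p : R)}) n (algebraMap R _ r)) = _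
  rw [AlgHom.commutes]
  rfl

/-- Functoriality of the `p`-adic completion. -/
def map (f : R →+* S) : PCompletion p R →+* PCompletion p S := lift p ((of p S).comp f)

theorem map_of (f : R →+* S) (r : R) : map p f (of p R r) = of p S (f r) := lift_of p _ r

end PCompletion

end PCompletion

/-! ### Fontaine's ring `A_cris(C)` -/

section Acris

variable (p : ℕ) [Fact p.Prime]

instance WittVector.algebraOfAlgebra (B B' : Type*) [CommRing B] [CommRing B'] [Algebra B B'] :
    Algebra (WittVector p B) (WittVector p B') :=
  (WittVector.map (algebraMap B B')).toAlgebra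

/-- The homomorphism `W(C♭) → C` induced by `ν₀ : C♭ → C`; it is surjective if `C` is
semiperfect. -/
def wittToBase (C : Type*) [CommRing C] [IsFpAlgebra p C] :
    WittVector p (Fontainization p C) →+* C :=
  (Fontainization.proj p C 0).comp WittVector.constantCoeff

/-- `A_cris(C)` for a semiperfect `𝔽_p`-algebra `C`: the `p`-adic completion of the PD hull of
`W(C♭) ↠ C`. -/
def Acris (C : Type*) [CommRing C] [IsFpAlgebra p C] :=
  PCompletion p (PDHull p (RingHom.ker (wittToBase p C)))

namespace Acris

instance (C : Type*) [CommRing C] [IsFpAlgebra p C] : CommRing (Acris p C) :=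
  inferInstanceAs (CommRing (PCompletion p (PDHull p (RingHom.ker (wittToBase p C)))))

/-- The canonical homomorphism `W(C♭) → A_cris(C)`. -/
def ofWitt (C : Type*) [CommRing C] [IsFpAlgebra p C] :
    WittVector p (Fontainization p C) →+* Acris p C :=
  (PCompletion.of p (PDHull p (RingHom.ker (wittToBase p C)))).comp (PDHull.of p _)

theorem wittToBase_map {C D : Type*} [CommRing C] [CommRing D] [IsFpAlgebra p C]
    [IsFpAlgebra p D] (f : C →+* D) (x : WittVector p (Fontainization p C)) :
    wittToBase p D (WittVector.map (Fontainization.map p f) x) = f (wittToBase p C x) := by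
  rfl

/-- Functoriality of `A_cris`. -/
def map {C D : Type*} [CommRing C] [CommRing D] [IsFpAlgebra p C] [IsFpAlgebra p D]
    (f : C →+* D) : Acris p C →+* Acris p D :=
  PCompletion.map p (PDHull.map p (WittVector.map (Fontainization.map p f)) (fun x hx => by
    rw [RingHom.mem_ker] at hx ⊢
    rw [wittToBase_map, hx, map_zero]))

theorem map_ofWitt {C D : Type*} [CommRing C] [CommRing D] [IsFpAlgebra p C] [IsFpAlgebra p D]
    (f : C →+* D) (x : WittVector p (Fontainization p C)) :
    map p f (ofWitt p C x) = ofWitt p D (WittVector.map (Fontainization.map p f) x) :=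
  (PCompletion.map_of p _ _).trans (congrArg _ (PDHull.map_of p _ _ x))

/-- The homomorphism `W(B) → W(C♭) → A_cris(C)` induced by a homomorphism `φ : B → C`, where `B`
is perfect. -/
def ofBase {B C : Type*} [CommRing B] [CommRing C] [IsFpAlgebra p B] [IsFpAlgebra p C]
    [PerfectRing B p] (φ : B →+* C) : WittVector p B →+* Acris p C :=
  (ofWitt p C).comp (WittVector.map (Fontainization.lift p φ))

theorem map_ofBase {B C D : Type*} [CommRing B] [CommRing C] [CommRing D] [IsFpAlgebra p B]
    [IsFpAlgebra p C] [IsFpAlgebra p D] [PerfectRing B p] (f : C →+* D) (φ : B →+* C)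
    (x : WittVector p B) : map p f (ofBase p φ x) = ofBase p (f.comp φ) x := by
  refine (map_ofWitt p f _).trans (congrArg (ofWitt p D) ?_)
  ext n
  rfl

theorem ofBase_map {B B' C : Type*} [CommRing B] [CommRing B'] [CommRing C] [IsFpAlgebra p B]
    [IsFpAlgebra p B'] [IsFpAlgebra p C] [PerfectRing B p] [PerfectRing B' p]
    (φ : B' →+* C) (ψ : B →+* B') (x : WittVector p B) :
    ofBase p φ (WittVector.map ψ x) = ofBase p (φ.comp ψ) x := by
  refine congrArg (ofWitt p C) ?_
  rw [← Fontainization.lift_comp p φ ψ]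
  ext n
  rfl

/-- If `B` is perfect and `C` is a `B`-algebra, then `A_cris(C)` is a `W(B)`-algebra. -/
instance (B C : Type*) [CommRing B] [CommRing C] [IsFpAlgebra p B] [IsFpAlgebra p C]
    [PerfectRing B p] [Algebra B C] : Algebra (WittVector p B) (Acris p C) :=
  (ofBase p (algebraMap B C)).toAlgebra

section BaseChange

variable (B B' C : Type*) [CommRing B] [CommRing B'] [CommRing C] [IsFpAlgebra p B]
  [IsFpAlgebra p B'] [IsFpAlgebra p C] [PerfectRing B p] [PerfectRing B' p] [Algebra B B']
  [Algebra B C]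

/-- The canonical homomorphism `A_cris(C) ⊗_{W(B)} W(B') → A_cris(C ⊗_B B')`: on `A_cris(C)` it is
induced by `C → C ⊗_B B'`, and on `W(B')` it is induced by `B' → C ⊗_B B'`. -/
def tensorMap : Acris p C ⊗[WittVector p B] WittVector p B' →+* Acris p (C ⊗[B] B') :=
  (Algebra.TensorProduct.lift (R := WittVector p B) (S := WittVector p B)
    ({ map p (Algebra.TensorProduct.includeLeft : C →ₐ[B] C ⊗[B] B').toRingHom with
        commutes' := fun x => (map_ofBase p _ _ x).trans rfl } :
      Acris p C →ₐ[WittVector p B] Acris p (C ⊗[B] B'))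
    ({ ofBase p (Algebra.TensorProduct.includeRight : B' →ₐ[B] C ⊗[B] B').toRingHom with
        commutes' := fun x => (ofBase_map p _ _ x).trans (by
          rw [AlgHom.toRingHom_eq_coe, AlgHom.comp_algebraMap]
          rfl) } :
      WittVector p B' →ₐ[WittVector p B] Acris p (C ⊗[B] B'))
    (fun _ _ => Commute.all _ _)).toRingHom

theorem tensorMap_tmul (x : Acris p C) (y : WittVector p B') :
    tensorMap p B B' C (x ⊗ₜ y) =
      map p (Algebra.TensorProduct.includeLeft : C →ₐ[B] C ⊗[B] B').toRingHom x *
        ofBase p (Algebra.TensorProduct.includeRight : B' →ₐ[B] C ⊗[B] B').toRingHom y :=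
  rfl

/-- The completed tensor product `A_cris(C) ⊗̂_{W(B)} W(B')`, i.e. the `p`-adic completion of
`A_cris(C) ⊗_{W(B)} W(B')`. -/
abbrev CompletedTensor := PCompletion p (Acris p C ⊗[WittVector p B] WittVector p B')

/-- The canonical homomorphism `A_cris(C) ⊗̂_{W(B)} W(B') → A_cris(C ⊗_B B')`, the `p`-adically
continuous extension of `tensorMap`. -/
def baseChangeMap : CompletedTensor p B B' C →+* Acris p (C ⊗[B] B') :=
  PCompletion.lift p (tensorMap p B B' C)

end BaseChange

end Acris

end Acris

end

/-!
Both completions may be compared modulo `p ^ n`, where the PD hulls are determined by their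
homomorphisms to rings `R` with `p ^ n = 0`. A homomorphism from the PD hull of `I ⊆ A` to `R` is a
homomorphism `A → R` together with a semilinear map `x ↦ ∑ γ_m(x) T ^ m` from `I` to the module of
exponential series over `R`. By the universal property of scalar extension, such a pair extends
uniquely along a flat base change of `A`, since the latter also base changes `I`.

For perfect `P` and `P → C`, such semilinear maps on the kernel of `W(P) → C` factor through
`W(P) / p ^ (n + 1)`. The formation of `W(P) / p ^ N` is compatible with base change from `W(B)` to
`W(B')`, by dévissage along the powers of `p`. The semilinear maps also vanish on the Witt vectors
whose components are `p ^ k`-th powers of elements of the kernel of `P → C`, for large `k`: up to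
multiples of `p`, such Witt vectors are high powers of elements with divided powers, and these are
divisible by large factorials. If `P → C` is surjective, the quotient of `W(P)` by these Witt
vectors is `W(C)`, whatever `P` is. Hence the perfect ring `B' ⊗ C♭`, which is the base change of
`C♭`, serves as well as `(C ⊗ B')♭`.
-/

noncomputable section

/-! ### Exponential series -/

/-- An exponential series `∑ a n * T ^ n`: a sequence with `a 0 = 1` and
`a m * a n = (m + n).choose m * a (m + n)`. The divided powers of an element form such a series;
sums and multiples of elements correspond to products and rescalings of series, so that a PD
structure on an ideal is a linear map to exponential series. -/
@[ext] structure ExpSeries (R : Type*) [CommRing R] where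
  coeff : ℕ → R
  coeff_zero : coeff 0 = 1
  coeff_mul_coeff : ∀ m n, coeff m * coeff n = (m + n).choose m * coeff (m + n)

namespace ExpSeries

open Finset hiding antidiagonal mem_antidiagonal
open HasAntidiagonal

variable {R : Type*} [CommRing R]

theorem sum_antidiagonal_shift (F : ℕ → ℕ → R) (i j n : ℕ)
    (hF : ∀ s t, s < i ∨ t < j → F s t = 0) :
    ∑ kl ∈ antidiagonal n, F (i + kl.1) (j + kl.2) =
      ∑ st ∈ antidiagonal (i + j + n), F st.1 st.2 := by
  refine sum_of_injOn (fun kl => (i + kl.1, j + kl.2)) ?_ ?_ ?_ fun _ _ => rfl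
  · rintro ⟨a, b⟩ _ ⟨c, d⟩ _ h
    simp only [Prod.mk.injEq] at h ⊢
    omega
  · rintro ⟨a, b⟩ h
    simp only [mem_coe, mem_antidiagonal] at h ⊢
    omega
  · rintro ⟨s, t⟩ h h'
    refine hF s t ?_
    by_contra! hc
    refine h' ⟨(s - i, t - j), ?_, ?_⟩
    · simp only [mem_coe, mem_antidiagonal] at h ⊢
      omega
    · simp only [Prod.mk.injEq]
      omega

theorem mul_sum_antidiagonal (a b : ExpSeries R) (i j n : ℕ) :
    a.coeff i * b.coeff j * ∑ kl ∈ antidiagonal n, a.coeff kl.1 * b.coeff kl.2 =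
      ∑ st ∈ antidiagonal (i + j + n),
        ((st.1.choose i * st.2.choose j : ℕ) : R) * (a.coeff st.1 * b.coeff st.2) := by
  rw [← sum_antidiagonal_shift (fun s t => ((s.choose i * t.choose j : ℕ) : R) *
    (a.coeff s * b.coeff t)) i j n, mul_sum]
  · refine sum_congr rfl fun kl _ => ?_
    push_cast
    linear_combination b.coeff j * b.coeff kl.2 * a.coeff_mul_coeff i kl.1 +
      (i + kl.1).choose i * a.coeff (i + kl.1) * b.coeff_mul_coeff j kl.2
  · rintro s t (h | h) <;> simp [Nat.choose_eq_zero_of_lt h]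

/-- Vandermonde's identity makes the product of two exponential series exponential. -/
theorem sum_antidiagonal_mul_sum_antidiagonal (a b : ExpSeries R) (m n : ℕ) :
    (∑ ij ∈ antidiagonal m, a.coeff ij.1 * b.coeff ij.2) *
        (∑ kl ∈ antidiagonal n, a.coeff kl.1 * b.coeff kl.2) =
      (m + n).choose m * ∑ st ∈ antidiagonal (m + n), a.coeff st.1 * b.coeff st.2 := by
  have expand : ∀ ij ∈ antidiagonal m, a.coeff ij.1 * b.coeff ij.2 *
      (∑ kl ∈ antidiagonal n, a.coeff kl.1 * b.coeff kl.2) = ∑ st ∈ antidiagonal (m + n),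
        ((st.1.choose ij.1 * st.2.choose ij.2 : ℕ) : R) * (a.coeff st.1 * b.coeff st.2) :=
    fun ij hij => by rw [mul_sum_antidiagonal, mem_antidiagonal.1 hij]
  rw [sum_mul, sum_congr rfl expand, sum_comm, mul_sum]
  refine sum_congr rfl fun st hst => ?_
  rw [← sum_mul, ← Nat.cast_sum, ← Nat.add_choose_eq, mem_antidiagonal.1 hst]

instance : Zero (ExpSeries R) where
  zero :=
    { coeff := Pi.single 0 1
      coeff_zero := Pi.single_eq_same 0 1
      coeff_mul_coeff := fun m n => by
        rcases Nat.eq_zero_or_pos m with rfl | hm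
        · simp
        · simp [hm.ne'] }

instance : Add (ExpSeries R) where
  add a b :=
    { coeff := fun n => ∑ ij ∈ antidiagonal n, a.coeff ij.1 * b.coeff ij.2
      coeff_zero := by simp [a.coeff_zero, b.coeff_zero]
      coeff_mul_coeff := sum_antidiagonal_mul_sum_antidiagonal a b }

theorem coeff_zero_of_ne_zero {n : ℕ} (hn : n ≠ 0) : (0 : ExpSeries R).coeff n = 0 :=
  Pi.single_eq_of_ne hn 1

theorem coeff_add (a b : ExpSeries R) (n : ℕ) :
    (a + b).coeff n = ∑ ij ∈ antidiagonal n, a.coeff ij.1 * b.coeff ij.2 := rfl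

theorem coeff_one_add (a b : ExpSeries R) : (a + b).coeff 1 = a.coeff 1 + b.coeff 1 := by
  simp [coeff_add, Nat.antidiagonal_succ, a.coeff_zero, b.coeff_zero, add_comm]

theorem eq_zero_of_coeff {a : ExpSeries R} (h : ∀ n ≠ 0, a.coeff n = 0) : a = 0 := by
  ext n
  rcases eq_or_ne n 0 with rfl | hn
  · rw [a.coeff_zero, coeff_zero]
  · rw [h n hn, coeff_zero_of_ne_zero hn]

theorem mk_add (a b : ExpSeries R) :
    PowerSeries.mk (a + b).coeff = PowerSeries.mk a.coeff * PowerSeries.mk b.coeff := by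
  ext n
  simp [PowerSeries.coeff_mul, coeff_add]

theorem mk_zero : PowerSeries.mk (0 : ExpSeries R).coeff = 1 := by
  ext n
  rcases eq_or_ne n 0 with rfl | hn
  · simp [coeff_zero]
  · simp [PowerSeries.coeff_one, coeff_zero_of_ne_zero, hn]

theorem mk_injective :
    Function.Injective fun a : ExpSeries R => PowerSeries.mk a.coeff := fun a b h => by
  ext n
  simpa using congrArg (PowerSeries.coeff n) h

instance : AddCommMonoid (ExpSeries R) where
  add_assoc a b c := mk_injective (by simp only [mk_add, mul_assoc])
  zero_add a := mk_injective (by simp only [mk_add, mk_zero, one_mul])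
  add_zero a := mk_injective (by simp only [mk_add, mk_zero, mul_one])
  add_comm a b := mk_injective (by simp only [mk_add, mul_comm])
  nsmul := nsmulRec

instance : SMul R (ExpSeries R) where
  smul r a :=
    { coeff := fun n => r ^ n * a.coeff n
      coeff_zero := by simp [a.coeff_zero]
      coeff_mul_coeff := fun m n => by
        linear_combination r ^ m * r ^ n * a.coeff_mul_coeff m n }

theorem coeff_smul (r : R) (a : ExpSeries R) (n : ℕ) : (r • a).coeff n = r ^ n * a.coeff n := rfl

instance : Module R (ExpSeries R) where
  one_smul a := by ext n; simp [coeff_smul]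
  mul_smul r s a := by ext n; simp [coeff_smul, mul_pow, mul_assoc]
  smul_zero r := eq_zero_of_coeff fun n hn => by simp [coeff_smul, coeff_zero_of_ne_zero hn]
  zero_smul a := eq_zero_of_coeff fun n hn => by simp [coeff_smul, hn]
  smul_add r a b := by
    ext n
    rw [coeff_smul, coeff_add, coeff_add, mul_sum]
    refine sum_congr rfl fun ij hij => ?_
    rw [coeff_smul, coeff_smul, ← mem_antidiagonal.1 hij, pow_add]
    ring
  add_smul r s a := by
    ext n
    rw [coeff_smul, coeff_add, (Commute.all r s).add_pow', sum_mul]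
    refine sum_congr rfl fun ij hij => ?_
    have h := a.coeff_mul_coeff ij.1 ij.2
    rw [mem_antidiagonal.1 hij] at h
    rw [coeff_smul, coeff_smul, nsmul_eq_mul]
    linear_combination -(r ^ ij.1 * s ^ ij.2) * h

/-- The image of an exponential series under a ring homomorphism. -/
def map {S : Type*} [CommRing S] (f : R →+* S) (a : ExpSeries R) : ExpSeries S where
  coeff n := f (a.coeff n)
  coeff_zero := by rw [a.coeff_zero, map_one]
  coeff_mul_coeff m n := by rw [← map_mul, a.coeff_mul_coeff, map_mul, map_natCast]

theorem coeff_map {S : Type*} [CommRing S] (f : R →+* S) (a : ExpSeries R) (n : ℕ) :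
    (a.map f).coeff n = f (a.coeff n) := rfl

theorem coeff_one_pow (a : ExpSeries R) (n : ℕ) : a.coeff 1 ^ n = n.factorial * a.coeff n := by
  induction n with
  | zero => simp [a.coeff_zero]
  | succ n ih =>
    have h := a.coeff_mul_coeff n 1
    rw [Nat.choose_succ_self_right] at h
    rw [pow_succ, ih, Nat.factorial_succ]
    push_cast at h ⊢
    linear_combination (n.factorial : R) * h

end ExpSeries

/-! ### The universal property of PD hulls -/

namespace PDHull

variable (p : ℕ) {A : Type*} [CommRing A] {I : Ideal A} {R : Type*} [CommRing R]

/-- A semilinear map `E` from `I` to exponential series over `R` is a PD system if it has the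
properties of `x ↦ ∑ γ_m(x) T ^ m` that the PD hull of `I` is universal for: `γ_1(x) = x` and, if
`p ∈ I`, `γ_m(p) = p ^ m / m!`, the latter written without division as in `pdHullIdeal`. -/
structure IsPDSystem {ρ : A →+* R} (E : I →ₛₗ[ρ] ExpSeries R) : Prop where
  coeff_one (x : I) : (E x).coeff 1 = ρ x
  den_mul_coeff (h : (p : A) ∈ I) (m : ℕ) :
    ((((p : ℚ) ^ m / (m.factorial : ℚ)).den : ℕ) : R) * (E ⟨p, h⟩).coeff m =
      ((((p : ℚ) ^ m / (m.factorial : ℚ)).num : ℤ) : R)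

theorem exists_dividedPowerAlgebra_lift {ρ : A →+* R} (E : I →ₛₗ[ρ] ExpSeries R) :
    ∃ Φ : DividedPowerAlgebra A I →+* R, (∀ a, Φ (algebraMap A _ a) = ρ a) ∧
      ∀ m x, Φ (DividedPowerAlgebra.dp A m x) = (E x).coeff m := by
  let := ρ.toAlgebra
  let f : ℕ × I → R := fun nx => (E nx.2).coeff nx.1
  have map_zero' (x : I) : f (0, x) = 1 := (E x).coeff_zero
  have map_smul' (n : ℕ) (a : A) (x : I) : f (n, a • x) = a ^ n • f (n, x) := by
    dsimp only [f]
    rw [map_smulₛₗ, ExpSeries.coeff_smul, Algebra.smul_def, map_pow]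
    rfl
  have map_mul' (m n : ℕ) (x : I) : f (m, x) * f (n, x) = (m + n).choose m • f (m + n, x) :=
    ((E x).coeff_mul_coeff m n).trans (nsmul_eq_mul _ _).symm
  have map_add' (n : ℕ) (x y : I) : f (n, x + y) =
      ∑ kl ∈ Finset.HasAntidiagonal.antidiagonal n, f (kl.1, x) * f (kl.2, y) := by
    dsimp only [f]
    rw [map_add, ExpSeries.coeff_add]
  let Φ : DividedPowerAlgebra A I →ₐ[A] R :=
    DividedPowerAlgebra.lift' map_zero' map_smul' map_mul' map_add'
  exact ⟨Φ, Φ.commutes, DividedPowerAlgebra.lift'_apply_dp map_zero' map_smul' map_mul' map_add'⟩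

variable {p} in
theorem IsPDSystem.exists_lift {ρ : A →+* R} {E : I →ₛₗ[ρ] ExpSeries R} (hE : IsPDSystem p E) :
    ∃ ψ : PDHull p I →+* R, (∀ a, ψ (of p I a) = ρ a) ∧
      ∀ m x, ψ (gamma p I m x) = (E x).coeff m := by
  obtain ⟨Φ, hΦ, hdp⟩ := exists_dividedPowerAlgebra_lift E
  have hker : pdHullIdeal p I ≤ RingHom.ker Φ := by
    refine Ideal.span_le.2 ?_
    rintro _ (⟨x, rfl⟩ | ⟨h, m, rfl⟩)
    · rw [SetLike.mem_coe, RingHom.mem_ker, map_sub, hdp, hΦ, hE.coeff_one, sub_self]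
    · rw [SetLike.mem_coe, RingHom.mem_ker, map_sub, map_mul, hdp, map_natCast, map_intCast,
        hE.den_mul_coeff, sub_self]
  exact ⟨Ideal.Quotient.lift _ Φ fun z hz => hker hz, hΦ, hdp⟩

variable {p} in
theorem ringHom_ext {f g : PDHull p I →+* R} (hof : f.comp (of p I) = g.comp (of p I))
    (hgamma : ∀ m x, f (gamma p I m x) = g (gamma p I m x)) : f = g := by
  refine Ideal.Quotient.ringHom_ext (RingHom.ext fun z => ?_)
  induction z using DividedPowerAlgebra.induction_on with
  | C a => exact RingHom.congr_fun hof a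
  | add x y hx hy => rw [map_add, map_add, hx, hy]
  | dp x n m hx => rw [map_mul, map_mul, hx]; exact congrArg _ (hgamma n m)

variable (I) in
/-- The divided powers of the elements of `I` in the PD hull, as exponential series. -/
def expGamma : I →ₛₗ[of p I] ExpSeries (PDHull p I) where
  toFun x :=
    { coeff := fun m => gamma p I m x
      coeff_zero := (congrArg _ DividedPowerAlgebra.dp_zero).trans (map_one _)
      coeff_mul_coeff := fun m n => by
        refine (map_mul (Ideal.Quotient.mk (pdHullIdeal p I)) _ _).symm.trans ?_
        rw [DividedPowerAlgebra.dp_mul, nsmul_eq_mul, map_mul, map_natCast]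
        rfl }
  map_add' x y := by
    ext n
    refine (congrArg (Ideal.Quotient.mk (pdHullIdeal p I)) DividedPowerAlgebra.dp_add).trans ?_
    rw [map_sum, ExpSeries.coeff_add]
    exact Finset.sum_congr rfl fun _ _ => map_mul _ _ _
  map_smul' a x := by
    ext n
    refine (congrArg (Ideal.Quotient.mk (pdHullIdeal p I)) DividedPowerAlgebra.dp_smul).trans ?_
    rw [Algebra.smul_def, map_mul, map_pow, map_pow]
    rfl

variable (I) in
theorem isPDSystem_expGamma : IsPDSystem p (expGamma p I) where
  coeff_one x := gamma_one p I x
  den_mul_coeff h m := by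
    have hmem := Ideal.Quotient.eq_zero_iff_mem.2
      (Ideal.subset_span (Or.inr ⟨h, m, rfl⟩) : _ ∈ pdHullIdeal p I)
    rw [map_sub, map_mul, map_natCast, map_intCast, sub_eq_zero] at hmem
    exact hmem

variable {p}

/-- The PD system `x ↦ ∑ ψ(γ_m(x)) T ^ m` given by a homomorphism `ψ` from the PD hull. -/
def expMap (ψ : PDHull p I →+* R) : I →ₛₗ[ψ.comp (of p I)] ExpSeries R where
  toFun x := (expGamma p I x).map ψ
  map_add' x y := by
    ext n
    simp only [map_add, ExpSeries.coeff_map, ExpSeries.coeff_add, map_sum, map_mul]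
  map_smul' a x := by
    ext n
    simp only [map_smulₛₗ, ExpSeries.coeff_map, ExpSeries.coeff_smul, map_mul, map_pow]
    rfl

theorem coeff_expMap (ψ : PDHull p I →+* R) (x : I) (m : ℕ) :
    (expMap ψ x).coeff m = ψ (gamma p I m x) := rfl

theorem coeff_one_expMap (ψ : PDHull p I →+* R) (x : I) :
    (expMap ψ x).coeff 1 = ψ (of p I x) :=
  congrArg ψ (gamma_one p I x)

theorem expMap_eq_zero_of_pow_dvd {n : ℕ} (hR : (p : R) ^ n = 0) (ψ : PDHull p I →+* R)
    (hpI : (p : A) ∈ I) {x : I} (hx : (p : A) ^ (n + 1) ∣ x) : expMap ψ x = 0 := by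
  obtain ⟨a, ha⟩ := hx
  have hx : x = (p : A) ^ n • (a • ⟨p, hpI⟩ : I) := Subtype.ext <| by
    rw [ha, pow_succ, mul_assoc, mul_comm (p : A)]
    rfl
  rw [hx, map_smulₛₗ, map_pow, map_natCast, hR, zero_smul]

theorem factorial_mul_gamma (m : ℕ) (x : I) :
    of p I (x : A) ^ m = m.factorial * gamma p I m x := by
  rw [← gamma_one]
  exact (expGamma p I x).coeff_one_pow m

theorem map_comp_map {A' A'' : Type*} [CommRing A'] [CommRing A''] {I' : Ideal A'} {I'' : Ideal A''}
    {f : A →+* A'} {g : A' →+* A''} (hf : ∀ x ∈ I, f x ∈ I') (hg : ∀ x ∈ I', g x ∈ I'') :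
    (map p g hg).comp (map p f hf) = map p (g.comp f) fun x hx => hg _ (hf x hx) := by
  refine ringHom_ext (RingHom.ext fun a => ?_) fun m x => ?_
  · simp only [RingHom.comp_apply, map_of]
  · simp only [RingHom.comp_apply, map_gamma]

section Extension

variable {A' : Type*} [CommRing A'] {I' : Ideal A'} {f : A →+* A'} {hf : ∀ x ∈ I, f x ∈ I'}

variable (hf) in
theorem comp_map_comp_of (ψ : PDHull p I' →+* R) :
    (ψ.comp (map p f hf)).comp (of p I) = (ψ.comp (of p I')).comp f :=
  RingHom.ext fun a => congrArg ψ (map_of p f hf a)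

theorem IsPDSystem.of_span {ρ : A →+* R} {E : I →ₛₗ[ρ] ExpSeries R} (hE : IsPDSystem p E)
    (hpI : (p : A) ∈ I)
    (hspan : Submodule.span A' (Set.range fun x : I => (⟨f x, hf x x.2⟩ : I')) = ⊤)
    {τ : A' →+* R} (hτ : τ.comp f = ρ) {E' : I' →ₛₗ[τ] ExpSeries R}
    (hE' : ∀ x : I, E' ⟨f x, hf x x.2⟩ = E x) : IsPDSystem p E' where
  coeff_one x' := by
    induction hspan.ge (Submodule.mem_top (x := x')) using Submodule.span_induction with
    | mem x' hx =>
      obtain ⟨x, rfl⟩ := hx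
      rw [hE', hE.coeff_one, ← hτ, RingHom.comp_apply]
    | zero => rw [map_zero, ExpSeries.coeff_zero_of_ne_zero one_ne_zero, ZeroMemClass.coe_zero,
        map_zero]
    | add x y _ _ hx hy => rw [map_add, ExpSeries.coeff_one_add, hx, hy, Submodule.coe_add, map_add]
    | smul a x _ hx => rw [map_smulₛₗ, ExpSeries.coeff_smul, hx, pow_one, Submodule.coe_smul,
        smul_eq_mul, map_mul]
  den_mul_coeff h' m := by
    have hfp : (⟨p, h'⟩ : I') = ⟨f (p : A), hf p hpI⟩ := Subtype.ext (map_natCast f p).symm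
    rw [hfp, hE' ⟨p, hpI⟩, hE.den_mul_coeff hpI m]

theorem isPDSystem_expMap (ψ : PDHull p I →+* R) : IsPDSystem p (expMap ψ) where
  coeff_one := coeff_one_expMap ψ
  den_mul_coeff h m := by
    rw [coeff_expMap, ← map_natCast ψ, ← map_mul, ← map_intCast ψ]
    exact congrArg ψ ((isPDSystem_expGamma p I).den_mul_coeff h m)

variable (hf) in
theorem exists_comp_map_eq (hpI : (p : A) ∈ I)
    (hspan : Submodule.span A' (Set.range fun x : I => (⟨f x, hf x x.2⟩ : I')) = ⊤)
    {ψ : PDHull p I →+* R} {τ : A' →+* R} (hτ : τ.comp f = ψ.comp (of p I))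
    {E' : I' →ₛₗ[τ] ExpSeries R} (hE' : ∀ x : I, E' ⟨f x, hf x x.2⟩ = expMap ψ x) :
    ∃ ψ' : PDHull p I' →+* R, ψ'.comp (map p f hf) = ψ ∧ ψ'.comp (of p I') = τ := by
  obtain ⟨ψ', hof, hgamma⟩ := ((isPDSystem_expMap ψ).of_span hpI hspan hτ hE').exists_lift
  refine ⟨ψ', ringHom_ext (RingHom.ext fun a => ?_) fun m x => ?_, RingHom.ext hof⟩
  · rw [← hτ, RingHom.comp_apply, RingHom.comp_apply, map_of, hof, RingHom.comp_apply]
  · rw [RingHom.comp_apply, map_gamma, hgamma, hE', coeff_expMap]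

theorem expMap_comp_map (ψ : PDHull p I' →+* R) (x : I) :
    expMap (ψ.comp (map p f hf)) x = expMap ψ ⟨f x, hf x x.2⟩ :=
  ExpSeries.ext (funext fun m => congrArg ψ (map_gamma p f hf m x))

theorem ringHom_ext_of_span
    (hspan : Submodule.span A' (Set.range fun x : I => (⟨f x, hf x x.2⟩ : I')) = ⊤)
    {ψ₁ ψ₂ : PDHull p I' →+* R} (hmap : ψ₁.comp (map p f hf) = ψ₂.comp (map p f hf))
    (hof : ψ₁.comp (of p I') = ψ₂.comp (of p I')) : ψ₁ = ψ₂ := by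
  suffices h : ∀ x' : I', expMap ψ₁ x' = expMap ψ₂ x' from
    ringHom_ext hof fun m x' => congrArg (ExpSeries.coeff · m) (h x')
  intro x'
  induction hspan.ge (Submodule.mem_top (x := x')) using Submodule.span_induction with
  | mem x' hx =>
    obtain ⟨x, rfl⟩ := hx
    rw [← expMap_comp_map, ← expMap_comp_map, hmap]
  | zero => rw [map_zero, map_zero]
  | add x y _ _ hx hy => rw [map_add, map_add, hx, hy]
  | smul a x _ hx => rw [map_smulₛₗ, map_smulₛₗ, hx, hof]

end Extension

end PDHull

theorem exists_semilinearMap_comp_eq {A A' R M M' Q : Type*} [Ring A] [Ring A'] [Semiring R]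
    [AddCommGroup M] [AddCommGroup M'] [AddCommMonoid Q] [Module A M] [Module A' M'] [Module R Q]
    {f : A →+* A'} {ρ : A →+* R} {τ : A' →+* R} (hτ : τ.comp f = ρ) (g : M →ₛₗ[f] M')
    (E : M →ₛₗ[ρ] Q) (hf : Function.Surjective f) (hg : Function.Surjective g)
    (hker : ∀ x, g x = 0 → E x = 0) : ∃ E' : M' →ₛₗ[τ] Q, ∀ x, E' (g x) = E x := by
  have eq_of_eq (x y : M) (h : g x = g y) : E x = E y := by
    rw [← sub_add_cancel x y, map_add, hker _ (by rw [map_sub, h, sub_self]), zero_add]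
  have apply_surjInv (x : M) : E (Function.surjInv hg (g x)) = E x :=
    eq_of_eq _ _ (Function.surjInv_eq hg _)
  refine ⟨{ toFun := fun y => E (Function.surjInv hg y), map_add' := ?_, map_smul' := ?_ },
    apply_surjInv⟩
  · refine hg.forall₂.2 fun x y => ?_
    rw [← map_add, apply_surjInv, apply_surjInv, apply_surjInv, map_add]
  · refine hf.forall.2 fun a => hg.forall.2 fun x => ?_
    have hτ' : ρ a = τ (f a) := (RingHom.congr_fun hτ a).symm
    rw [← map_smulₛₗ, apply_surjInv, apply_surjInv, map_smulₛₗ, hτ']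

namespace PDHull

variable {p : ℕ} {A A' R : Type*} [CommRing A] [CommRing A'] [CommRing R] {I : Ideal A}
  {I' : Ideal A'} {f : A →+* A'} (hf : ∀ x ∈ I, f x ∈ I')

include hf in
theorem surjective_codRestrict (hfs : Function.Surjective f) (hI : I'.comap f ≤ I) :
    Function.Surjective fun x : I => (⟨f x, hf x x.2⟩ : I') := by
  rintro ⟨y, hy⟩
  obtain ⟨x, rfl⟩ := hfs y
  exact ⟨⟨x, hI hy⟩, rfl⟩

theorem exists_comp_map_eq_of_surjective (hpI : (p : A) ∈ I) (hfs : Function.Surjective f)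
    (hI : I'.comap f ≤ I) {ψ : PDHull p I →+* R} (hψ : ∀ x : I, f x = 0 → expMap ψ x = 0) :
    ∃ ψ' : PDHull p I' →+* R, ψ'.comp (map p f hf) = ψ := by
  have hker : RingHom.ker f ≤ RingHom.ker (ψ.comp (of p I)) := fun a (ha : f a = 0) => by
    have haI : a ∈ I := hI (I'.mem_comap.2 (by rw [ha]; exact I'.zero_mem))
    rw [RingHom.mem_ker, RingHom.comp_apply, ← coeff_one_expMap ψ ⟨a, haI⟩, hψ ⟨a, haI⟩ ha,
      ExpSeries.coeff_zero_of_ne_zero one_ne_zero]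
  have hτ := RingHom.liftOfSurjective_comp f hfs ⟨ψ.comp (of p I), hker⟩
  let g : I →ₛₗ[f] I' :=
    { toFun := fun x => ⟨f x, hf x x.2⟩
      map_add' := fun x y => Subtype.ext (map_add f (x : A) (y : A))
      map_smul' := fun a x => Subtype.ext (map_mul f a (x : A)) }
  have hg := surjective_codRestrict hf hfs hI
  obtain ⟨E', hE'⟩ := exists_semilinearMap_comp_eq hτ g (expMap ψ) hfs hg
    fun x hx => hψ x (congrArg Subtype.val hx)
  obtain ⟨ψ', hψ', -⟩ := exists_comp_map_eq hf hpI
    (by rw [hg.range_eq, Submodule.span_univ]) hτ hE'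
  exact ⟨ψ', hψ'⟩

theorem ringHom_ext_of_surjective (hfs : Function.Surjective f) (hI : I'.comap f ≤ I)
    {ψ₁ ψ₂ : PDHull p I' →+* R} (hmap : ψ₁.comp (map p f hf) = ψ₂.comp (map p f hf)) :
    ψ₁ = ψ₂ := by
  refine ringHom_ext_of_span
    (by rw [(surjective_codRestrict hf hfs hI).range_eq, Submodule.span_univ]) hmap
    ((RingHom.cancel_right hfs).1 (RingHom.ext fun a => ?_))
  simpa only [RingHom.comp_apply, map_of] using RingHom.congr_fun hmap (of p I a)

theorem bijective_comp_map_of_surjective {A'' : Type*} [CommRing A''] {J : Ideal A''}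
    {g : A' →+* A''} (hg : ∀ x ∈ I', g x ∈ J) (hpI : (p : A) ∈ I) (hgs : Function.Surjective g)
    (hgfs : Function.Surjective (g.comp f)) (hJ : J.comap g ≤ I') (hI : J.comap (g.comp f) ≤ I)
    (hψ' : ∀ (ψ' : PDHull p I' →+* R) (x : I'), g x = 0 → expMap ψ' x = 0)
    (hψ : ∀ (ψ : PDHull p I →+* R) (x : I), g (f x) = 0 → expMap ψ x = 0) :
    Function.Bijective fun ψ : PDHull p I' →+* R => ψ.comp (map p f hf) := by
  have hpI' : (p : A') ∈ I' := map_natCast f p ▸ hf p hpI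
  have hgf : ∀ x ∈ I, g.comp f x ∈ J := fun x hx => hg _ (hf x hx)
  constructor
  · intro ψ₁ ψ₂ h
    obtain ⟨χ₁, rfl⟩ := exists_comp_map_eq_of_surjective hg hpI' hgs hJ (hψ' ψ₁)
    obtain ⟨χ₂, rfl⟩ := exists_comp_map_eq_of_surjective hg hpI' hgs hJ (hψ' ψ₂)
    simp only [RingHom.comp_assoc, map_comp_map] at h
    rw [ringHom_ext_of_surjective hgf hgfs hI h]
  · intro ψ
    obtain ⟨χ, rfl⟩ := exists_comp_map_eq_of_surjective hgf hpI hgfs hI (hψ ψ)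
    exact ⟨χ.comp (map p g hg), by simp only [RingHom.comp_assoc, map_comp_map]⟩

end PDHull

/-! ### Perfect rings over a given quotient -/

section Approximation

variable {p : ℕ} [Fact p.Prime]

theorem IsFpAlgebra.charP {R : Type*} [CommRing R] [IsFpAlgebra p R] [Nontrivial R] : CharP R p :=
  (CharP.charP_iff_prime_eq_zero Fact.out).2 IsFpAlgebra.natCast_eq_zero

theorem pow_dvd_factorial_mul (n : ℕ) : p ^ n ∣ (n * p).factorial := by
  induction n with
  | zero => exact one_dvd _
  | succ n ih =>
    rw [pow_succ, add_mul, one_mul]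
    exact (mul_dvd_mul ih (Nat.dvd_factorial (Nat.Prime.pos Fact.out) le_rfl)).trans
      (Nat.factorial_mul_factorial_dvd_factorial_add _ _)

theorem exists_eq_teichmuller_add_mul {P : Type*} [CommRing P] [IsFpAlgebra p P]
    [PerfectRing P p] (x : WittVector p P) :
    ∃ w : WittVector p P, x = WittVector.teichmuller p (x.coeff 0) + p * w ∧
      ∀ j, w.coeff j ^ p = x.coeff (j + 1) := by
  let w := WittVector.mk p fun j => (perfectFrobenius p P).symm (x.coeff (j + 1))
  have hw (j : ℕ) : w.coeff j ^ p = x.coeff (j + 1) :=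
    (perfectFrobenius p P).apply_symm_apply (x.coeff (j + 1))
  refine ⟨w, ?_, hw⟩
  rcases subsingleton_or_nontrivial P
  · exact WittVector.ext fun _ => Subsingleton.elim _ _
  have := IsFpAlgebra.charP (p := p) (R := P)
  ext j
  rw [mul_comm, WittVector.coeff_add_of_disjoint]
  · rcases j with _ | j
    · rw [WittVector.teichmuller_coeff_zero, WittVector.mul_charP_coeff_zero, add_zero]
    · rw [WittVector.teichmuller_coeff_pos p _ _ j.succ_pos, WittVector.mul_charP_coeff_succ, hw,
        zero_add]
  · rintro (_ | i)
    · exact Or.inr (WittVector.mul_charP_coeff_zero w)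
    · exact Or.inl (WittVector.teichmuller_coeff_pos p _ _ i.succ_pos)

namespace PDHull

variable {A : Type*} [CommRing A] {I : Ideal A} {R : Type*} [CommRing R] {n : ℕ}

theorem map_of_pow_eq_zero (hR : (p : R) ^ n = 0) (ψ : PDHull p I →+* R) (x : I) {m : ℕ}
    (hm : n * p ≤ m) : ψ (of p I x) ^ m = 0 := by
  obtain ⟨d, hd⟩ := (pow_dvd_factorial_mul (p := p) n).trans (Nat.factorial_dvd_factorial hm)
  rw [← map_pow, factorial_mul_gamma, hd]
  push_cast
  rw [map_mul, map_mul, map_pow, map_natCast, hR, zero_mul, zero_mul]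

end PDHull

section Perfect

open WittVector

variable {P C : Type*} [CommRing P] [CommRing C]

variable (p) in
/-- The kernel of the homomorphism `W(P) → C` given by `π : P → C`. -/
abbrev wittIdeal (π : P →+* C) : Ideal (WittVector p P) :=
  RingHom.ker (π.comp constantCoeff)

theorem natCast_mem_wittIdeal [IsFpAlgebra p C] (π : P →+* C) :
    (p : WittVector p P) ∈ wittIdeal p π := by
  rw [RingHom.mem_ker, map_natCast, IsFpAlgebra.natCast_eq_zero]

variable {Q : Type*} [CommRing Q]

theorem map_mem_wittIdeal {g : P →+* Q} {π : P →+* C} {ρ : Q →+* C} (hg : ρ.comp g = π) :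
    ∀ x ∈ wittIdeal p π, WittVector.map g x ∈ wittIdeal p ρ := by
  subst hg
  exact fun x hx => hx

variable [IsFpAlgebra p P] [PerfectRing P p]

variable (p) in
/-- The homomorphism `W(P) → W(C)` induced by `π : P → C` precomposed with the inverse of the
`k`-fold Frobenius of `P`. Its kernel consists of the Witt vectors whose components are `p ^ k`-th
powers of elements of the kernel of `π`. -/
def twistedMap (π : P →+* C) (k : ℕ) : WittVector p P →+* WittVector p C :=
  WittVector.map (π.comp ((perfectFrobenius p P)⁻¹ ^ k : RingAut P).toRingHom)

theorem coeff_twistedMap (π : P →+* C) (k : ℕ) (x : WittVector p P) (j : ℕ) :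
    (twistedMap p π k x).coeff j = π (((perfectFrobenius p P)⁻¹ ^ k) (x.coeff j)) := rfl

theorem perfectFrobenius_inv_pow_succ_apply (k : ℕ) (y : P) :
    ((perfectFrobenius p P)⁻¹ ^ (k + 1)) (y ^ p) = ((perfectFrobenius p P)⁻¹ ^ k) y := by
  rw [pow_succ, RingAut.mul_apply]
  exact congrArg _ ((perfectFrobenius p P).symm_apply_apply y)

theorem perfectFrobenius_inv_pow_apply_pow (k : ℕ) (y : P) :
    ((perfectFrobenius p P)⁻¹ ^ k) y ^ p ^ k = y := by
  induction k generalizing y with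
  | zero => rw [pow_zero, pow_zero, pow_one, RingAut.one_apply]
  | succ k ih =>
    rw [← map_pow, pow_succ p, pow_mul, perfectFrobenius_inv_pow_succ_apply, map_pow, ih]

theorem surjective_twistedMap {π : P →+* C} (hπ : Function.Surjective π) (k : ℕ) :
    Function.Surjective (twistedMap p π k) :=
  WittVector.map_surjective _ (hπ.comp (RingEquiv.surjective _))

theorem ker_twistedMap_le (π : P →+* C) (k : ℕ) :
    RingHom.ker (twistedMap p π k) ≤ wittIdeal p π := fun x hx => by
  have h0 : π (((perfectFrobenius p P)⁻¹ ^ k) (x.coeff 0)) = 0 := by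
    rw [← coeff_twistedMap, RingHom.mem_ker.1 hx, zero_coeff]
  rw [RingHom.mem_ker, RingHom.comp_apply, constantCoeff_apply,
    ← perfectFrobenius_inv_pow_apply_pow (p := p) k (x.coeff 0), map_pow, h0,
    zero_pow (pow_ne_zero k (Nat.Prime.ne_zero Fact.out))]

theorem exists_of_twistedMap_eq_zero {π : P →+* C} {k : ℕ} {x : WittVector p P}
    (hx : twistedMap p π (k + 1) x = 0) :
    ∃ y ∈ wittIdeal p π, ∃ w, twistedMap p π k w = 0 ∧ x = y ^ p ^ (k + 1) + p * w := by
  have hx (j : ℕ) : π (((perfectFrobenius p P)⁻¹ ^ (k + 1)) (x.coeff j)) = 0 := by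
    rw [← coeff_twistedMap, hx, zero_coeff]
  obtain ⟨w, hxw, hw⟩ := exists_eq_teichmuller_add_mul x
  refine ⟨teichmuller p (((perfectFrobenius p P)⁻¹ ^ (k + 1)) (x.coeff 0)), ?_, w, ?_, ?_⟩
  · rw [RingHom.mem_ker, RingHom.comp_apply, constantCoeff_apply, teichmuller_coeff_zero, hx]
  · ext j
    rw [coeff_twistedMap, ← perfectFrobenius_inv_pow_succ_apply, hw, hx, zero_coeff]
  · rw [← map_pow, perfectFrobenius_inv_pow_apply_pow]
    exact hxw

variable {R : Type*} [CommRing R] {n : ℕ}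

theorem pow_dvd_of_twistedMap_eq_zero (hR : (p : R) ^ n = 0) {π : P →+* C}
    (ψ : PDHull p (wittIdeal p π) →+* R) {i : ℕ} {x : WittVector p P}
    (hx : twistedMap p π (n * p + i) x = 0) : (p : R) ^ i ∣ ψ (PDHull.of p _ x) := by
  induction i generalizing x with
  | zero => exact (pow_zero (p : R)).symm ▸ one_dvd _
  | succ i ih =>
    obtain ⟨y, hy, w, hw, rfl⟩ := exists_of_twistedMap_eq_zero (k := n * p + i) hx
    have hm : n * p ≤ p ^ (n * p + i + 1) :=
      (Nat.le_add_right _ (i + 1)).trans (Nat.lt_pow_self (Nat.Prime.one_lt Fact.out)).le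
    have hyR := PDHull.map_of_pow_eq_zero hR ψ ⟨y, hy⟩ hm
    rw [map_add, map_add, map_pow, map_pow, hyR, zero_add, map_mul, map_mul, map_natCast,
      map_natCast, pow_succ']
    exact mul_dvd_mul_left _ (ih hw)

theorem expMap_eq_zero_of_twistedMap_eq_zero [IsFpAlgebra p C] (hR : (p : R) ^ n = 0)
    {π : P →+* C} (ψ : PDHull p (wittIdeal p π) →+* R) (x : wittIdeal p π)
    (hx : twistedMap p π (n * p + n + 1) (x : WittVector p P) = 0) : PDHull.expMap ψ x = 0 := by
  obtain ⟨y, hy, w, hw, hxyw⟩ := exists_of_twistedMap_eq_zero hx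
  have hlt : n * p + n + 1 < p ^ (n * p + n + 1) := Nat.lt_pow_self (Nat.Prime.one_lt Fact.out)
  have hyR := PDHull.map_of_pow_eq_zero hR ψ ⟨y, hy⟩ (m := p ^ (n * p + n + 1) - 1) (by omega)
  have hwR : ψ (PDHull.of p _ w) = 0 := by
    obtain ⟨r, hr⟩ := pow_dvd_of_twistedMap_eq_zero hR ψ hw
    rw [hr, hR, zero_mul]
  have hx : x = y ^ (p ^ (n * p + n + 1) - 1) • (⟨y, hy⟩ : wittIdeal p π) +
      w • ⟨p, natCast_mem_wittIdeal π⟩ := by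
    refine Subtype.ext (hxyw.trans ?_)
    rw [Submodule.coe_add, Submodule.coe_smul, Submodule.coe_smul, smul_eq_mul, smul_eq_mul,
      pow_sub_one_mul (by omega), mul_comm w]
  rw [hx, map_add, map_smulₛₗ, map_smulₛₗ, RingHom.comp_apply, RingHom.comp_apply, map_pow, map_pow,
    hyR, hwR, zero_smul, zero_smul, add_zero]

variable [IsFpAlgebra p Q] [PerfectRing Q p]

theorem twistedMap_comp_map {g : P →+* Q} {π : P →+* C} {ρ : Q →+* C} (hg : ρ.comp g = π)
    (k : ℕ) : (twistedMap p ρ k).comp (WittVector.map g) = twistedMap p π k := by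
  subst hg
  ext x j
  have h := RingHom.congr_fun (Fontainization.lift_comp p (RingHom.id Q) g) (x.coeff j)
  exact congrArg ρ (congrFun (congrArg Subtype.val h) k)

theorem bijective_comp_map_of_perfect [IsFpAlgebra p C] (hR : (p : R) ^ n = 0) {g : P →+* Q}
    {π : P →+* C} {ρ : Q →+* C} (hg : ρ.comp g = π) (hπ : Function.Surjective π) :
    Function.Bijective fun ψ : PDHull p (wittIdeal p ρ) →+* R =>
      ψ.comp (PDHull.map p (WittVector.map g) (map_mem_wittIdeal hg)) := by
  have hρ : Function.Surjective ρ := .of_comp (g := g) (by rwa [← RingHom.coe_comp, hg])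
  let k := n * p + n + 1
  have hcomp := twistedMap_comp_map (p := p) hg k
  let J := (wittIdeal p ρ).map (twistedMap p ρ k)
  have hJ : J.comap (twistedMap p ρ k) ≤ wittIdeal p ρ := by
    rw [Ideal.comap_map_of_surjective _ (surjective_twistedMap hρ k)]
    exact sup_le le_rfl (ker_twistedMap_le ρ k)
  have hI : J.comap ((twistedMap p ρ k).comp (WittVector.map g)) ≤ wittIdeal p π := fun x hx => by
    subst hg
    exact hJ hx
  refine PDHull.bijective_comp_map_of_surjective _ (fun x hx => Ideal.mem_map_of_mem _ hx)
    (natCast_mem_wittIdeal π) (surjective_twistedMap hρ k) (hcomp ▸ surjective_twistedMap hπ k)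
    hJ hI (expMap_eq_zero_of_twistedMap_eq_zero hR) fun ψ x hx =>
      expMap_eq_zero_of_twistedMap_eq_zero hR ψ x ?_
  rw [← hcomp]
  exact hx

end Perfect

end Approximation

/-! ### Base change of ideals -/

section BaseChange

variable {R S : Type*} [CommRing R] [CommRing S] [Algebra R S]

theorem isBaseChange_iff_bijective_liftBaseChange {M M' : Type*} [AddCommMonoid M]
    [AddCommMonoid M'] [Module R M] [Module R M'] [Module S M'] [IsScalarTower R S M']
    {h : M →ₗ[R] M'} : IsBaseChange S h ↔ Function.Bijective (h.liftBaseChange S) :=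
  Iff.rfl

theorem isBaseChange_of_exact {L M Q L' M' Q' : Type*}
    [AddCommGroup L] [AddCommGroup M] [AddCommGroup Q] [AddCommGroup L'] [AddCommGroup M']
    [AddCommGroup Q'] [Module R L] [Module R M] [Module R Q] [Module R L'] [Module R M']
    [Module R Q'] [Module S L'] [Module S M'] [Module S Q'] [IsScalarTower R S L']
    [IsScalarTower R S M'] [IsScalarTower R S Q'] {hL : L →ₗ[R] L'} {hM : M →ₗ[R] M'}
    {hQ : Q →ₗ[R] Q'} {f : L →ₗ[R] M} {g : M →ₗ[R] Q} {f' : L' →ₗ[S] M'} {g' : M' →ₗ[S] Q'}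
    (commf : hM ∘ₗ f = f'.restrictScalars R ∘ₗ hL) (commg : hQ ∘ₗ g = g'.restrictScalars R ∘ₗ hM)
    (hLb : IsBaseChange S hL) (hQb : IsBaseChange S hQ) (hfg : Function.Exact f g)
    (hg : Function.Surjective g) (hfg' : Function.Exact f' g') (hf' : Function.Injective f') :
    IsBaseChange S hM := by
  rw [isBaseChange_iff_bijective_liftBaseChange] at hLb hQb ⊢
  have commf' (x : S ⊗[R] L) :
      hM.liftBaseChange S (f.lTensor S x) = f' (hL.liftBaseChange S x) := by
    induction x with
    | zero => simp only [map_zero]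
    | add x y hx hy => simp only [map_add, hx, hy]
    | tmul s x => simpa using congr(s • $commf x)
  have commg' (x : S ⊗[R] M) :
      hQ.liftBaseChange S (g.lTensor S x) = g' (hM.liftBaseChange S x) := by
    induction x with
    | zero => simp only [map_zero]
    | add x y hx hy => simp only [map_add, hx, hy]
    | tmul s x => simpa using congr(s • $commg x)
  constructor
  · refine (injective_iff_map_eq_zero _).2 fun x hx => ?_
    obtain ⟨y, rfl⟩ := (lTensor_exact S hfg hg x).1
      (hQb.1 (by rw [commg', hx, map_zero, map_zero]))
    have hy : y = 0 := hLb.1 (hf' (by rw [← commf', hx, map_zero, map_zero]))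
    rw [hy, map_zero]
  · intro x'
    obtain ⟨y, hy⟩ := hQb.2 (g' x')
    obtain ⟨x, rfl⟩ := LinearMap.lTensor_surjective S hg y
    obtain ⟨z', hz'⟩ := (hfg' (x' - hM.liftBaseChange S x)).1
      (by rw [map_sub, ← commg', hy, sub_self])
    obtain ⟨z, rfl⟩ := hLb.2 z'
    exact ⟨f.lTensor S z + x, by rw [map_add, commf', hz', sub_add_cancel]⟩

theorem isBaseChange_restrictScalars_of_isPushout {A A' M M' : Type*} [CommRing A] [CommRing A']
    [Algebra R A] [Algebra S A'] [Algebra A A'] [Algebra R A'] [IsScalarTower R A A']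
    [IsScalarTower R S A'] [Algebra.IsPushout R S A A'] [AddCommGroup M] [AddCommGroup M']
    [Module R M] [Module A M] [IsScalarTower R A M] [Module A M'] [Module A' M']
    [IsScalarTower A A' M'] [Module R M'] [Module S M'] [IsScalarTower R A M']
    [IsScalarTower R S M'] [IsScalarTower S A' M'] {h : M →ₗ[A] M'} (hh : IsBaseChange A' h) :
    IsBaseChange S (h.restrictScalars R) :=
  .of_equiv ((Algebra.IsPushout.cancelBaseChange R S A A' M).symm ≪≫ₗ hh.equiv.restrictScalars S)
    fun x => by simp [hh.equiv_tmul]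

section Ideal

variable {A A' : Type*} [CommRing A] [CommRing A'] [Algebra R A'] [Algebra S A']
  [IsScalarTower R S A'] [Algebra R A]

/-- The linear map `I → I'` between ideals given by a homomorphism of algebras. -/
def idealMap (h : A →ₐ[R] A') {I : Ideal A} {I' : Ideal A'} (hI : ∀ x ∈ I, h x ∈ I') :
    I →ₗ[R] I' where
  toFun x := ⟨h x, hI x x.2⟩
  map_add' x y := Subtype.ext (map_add h (x : A) (y : A))
  map_smul' r x := Subtype.ext (map_smul h r (x : A))

theorem isBaseChange_idealMap_top_iff {h : A →ₐ[R] A'} :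
    IsBaseChange S (idealMap h (I := ⊤) (I' := ⊤) fun _ _ => trivial) ↔
      IsBaseChange S h.toLinearMap :=
  IsBaseChange.iff_of_equiv_comm (Submodule.topEquiv.restrictScalars R)
    (Submodule.topEquiv.restrictScalars S) rfl

theorem isBaseChange_idealMap_ker [Module.Flat R S] {C C' : Type*} [CommRing C] [CommRing C']
    [Algebra R C] [Algebra R C'] [Algebra S C'] [IsScalarTower R S C'] {h : A →ₐ[R] A'}
    {k : C →ₐ[R] C'} {π : A →ₐ[R] C} {π' : A' →ₐ[S] C'}
    (comm : k.comp π = (π'.restrictScalars R).comp h)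
    (hh : IsBaseChange S h.toLinearMap) (hk : IsBaseChange S k.toLinearMap)
    (hI : ∀ x ∈ RingHom.ker π, h x ∈ RingHom.ker π') : IsBaseChange S (idealMap h hI) :=
  .of_left_exact S (f := (RingHom.ker π).subtype.restrictScalars R) (g := π.toLinearMap)
    (f' := (RingHom.ker π').subtype.restrictScalars S) (g' := π'.toLinearMap)
    _ h.toLinearMap k.toLinearMap rfl (LinearMap.ext fun x => AlgHom.congr_fun comm x) hh hk
    (LinearMap.exact_subtype_ker_map π.toLinearMap) Subtype.val_injective
    (LinearMap.exact_subtype_ker_map π'.toLinearMap) Subtype.val_injective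

end Ideal

end BaseChange

/-! ### Reductions modulo powers of `p` -/

section ModPow

variable (p N : ℕ)

/-- The quotient `A / p ^ N A`. -/
abbrev ModPow (A : Type*) [CommRing A] := A ⧸ Ideal.span {(p : A) ^ N}

namespace ModPow

variable {R A A' P P' : Type*} [CommRing R] [CommRing A] [CommRing A'] [CommRing P] [CommRing P']
  [Algebra R A] [Algebra R A'] [Algebra R P] [Algebra R P']

variable {p N} in
theorem mk_eq_zero_iff {a : A} :
    Ideal.Quotient.mk (Ideal.span {(p : A) ^ N}) a = 0 ↔ (p : A) ^ N ∣ a := by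
  rw [Ideal.Quotient.eq_zero_iff_mem, Ideal.mem_span_singleton]

instance : Subsingleton (ModPow p 0 A) :=
  Ideal.Quotient.subsingleton_iff.2 (by rw [pow_zero, Ideal.span_singleton_one])

/-- Functoriality of `A / p ^ N A`. -/
def map (h : A →ₐ[R] A') : ModPow p N A →ₐ[R] ModPow p N A' :=
  Ideal.quotientMapₐ _ h <| by
    rw [Ideal.span_singleton_le_iff_mem, Ideal.mem_comap, map_pow, map_natCast]
    exact Ideal.mem_span_singleton_self _

/-- The multiplication by `p`, as an injection of `A / p ^ N A` into `A / p ^ (N + 1) A` when `p` is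
a nonzerodivisor of `A`. -/
def mulP : ModPow p N A →ₗ[A] ModPow p (N + 1) A :=
  Submodule.mapQ _ _ (LinearMap.mulLeft A (p : A)) <| by
    rw [Submodule.span_singleton_le_iff_mem, Submodule.mem_comap, LinearMap.mulLeft_apply,
      ← pow_succ']
    exact Ideal.mem_span_singleton_self _

variable {p N}

theorem mulP_mk (a : A) :
    mulP p N (Ideal.Quotient.mk _ a) = Ideal.Quotient.mk _ ((p : A) * a) := rfl

theorem mulP_injective (hp : IsLeftRegular (p : A)) : Function.Injective (mulP p N (A := A)) := by
  refine (injective_iff_map_eq_zero _).2 (Ideal.Quotient.mk_surjective.forall.2 fun a ha => ?_)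
  rw [mulP_mk, mk_eq_zero_iff, pow_succ'] at ha
  obtain ⟨b, hb⟩ := ha
  exact mk_eq_zero_iff.2 ⟨b, hp (hb.trans (mul_assoc _ _ _))⟩

section Reduction

variable {π : A →ₐ[R] P} (hπ : RingHom.ker π = Ideal.span {(p : A)})

variable (N) in
/-- The homomorphism `A / p ^ (N + 1) A → P` induced by a homomorphism `A → P` with kernel
`p A`. -/
def toBase : ModPow p (N + 1) A →ₐ[R] P :=
  Ideal.Quotient.liftₐ _ π fun a ha => by
    rw [← RingHom.mem_ker, hπ, Ideal.mem_span_singleton]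
    exact (dvd_pow_self _ N.succ_ne_zero).trans (Ideal.mem_span_singleton.1 ha)

theorem toBase_mk (a : A) : toBase N hπ (Ideal.Quotient.mk _ a) = π a := rfl

theorem exact_mulP_toBase : Function.Exact (mulP p N (A := A)) (toBase N hπ) := by
  refine Ideal.Quotient.mk_surjective.forall.2 fun a => ?_
  rw [toBase_mk, ← RingHom.mem_ker, hπ, Ideal.mem_span_singleton]
  constructor
  · rintro ⟨b, rfl⟩
    exact ⟨Ideal.Quotient.mk _ b, mulP_mk b⟩
  · rintro ⟨b, hb⟩
    obtain ⟨b, rfl⟩ := Ideal.Quotient.mk_surjective b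
    rw [mulP_mk, ← sub_eq_zero, ← map_sub, mk_eq_zero_iff] at hb
    exact (dvd_sub_right (dvd_mul_right _ _)).1 ((dvd_pow_self _ N.succ_ne_zero).trans hb)

variable (K : Ideal P)

/-- `mulP` as a map into the preimage of an ideal of `P`. -/
def mulPIdeal : ModPow p N A →ₗ[R] K.comap (toBase N hπ) where
  toFun x := ⟨mulP p N x, by
    rw [Ideal.mem_comap, (exact_mulP_toBase hπ _).2 ⟨x, rfl⟩]
    exact K.zero_mem⟩
  map_add' x y := Subtype.ext (map_add _ x y)
  map_smul' r x := Subtype.ext (LinearMap.map_smul_of_tower _ r x)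

theorem exact_mulPIdeal_idealMap : Function.Exact (mulPIdeal hπ K (N := N))
    (idealMap (toBase N hπ) (I := K.comap (toBase N hπ)) (I' := K) fun _ hx => hx) := fun x =>
  Subtype.ext_iff.trans <| (exact_mulP_toBase (N := N) hπ x.1).trans
    ⟨fun ⟨y, hy⟩ => ⟨y, Subtype.ext hy⟩, fun ⟨y, hy⟩ => ⟨y, congrArg Subtype.val hy⟩⟩

theorem toBase_surjective (hπs : Function.Surjective π) :
    Function.Surjective (toBase N hπ) :=
  .of_comp (g := Ideal.Quotient.mk _) hπs

end Reduction

section BaseChange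

variable {S : Type*} [CommRing S] [Algebra R S] [Algebra S A'] [Algebra S P'] [IsScalarTower R S A']
  [IsScalarTower R S P'] {h : A →ₐ[R] A'} {k : P →ₐ[R] P'} {π : A →ₐ[R] P} {π' : A' →ₐ[S] P'}
  (comm : k.comp π = (π'.restrictScalars R).comp h)
  (hπ : RingHom.ker π = Ideal.span {(p : A)}) (hπ' : RingHom.ker π' = Ideal.span {(p : A')})

include comm in
theorem toBase_map (x : ModPow p (N + 1) A) :
    toBase N hπ' (map p (N + 1) h x) = k (toBase N hπ x) := by
  obtain ⟨a, rfl⟩ := Ideal.Quotient.mk_surjective x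
  exact (AlgHom.congr_fun comm a).symm

variable {K : Ideal P} {K' : Ideal P'} (hK : ∀ x ∈ K, k x ∈ K')

include comm hK in
theorem map_mem_comap_toBase :
    ∀ x ∈ K.comap (toBase N hπ), map p (N + 1) h x ∈ K'.comap (toBase N hπ') := fun x hx => by
  rw [Ideal.mem_comap, toBase_map comm hπ]
  exact hK _ hx

theorem isBaseChange_idealMap_succ (hπs : Function.Surjective π)
    (hp : IsLeftRegular (p : A')) (hK_base : IsBaseChange S (idealMap k hK))
    (ih : IsBaseChange S (map p N h).toLinearMap) :
    IsBaseChange S (idealMap (map p (N + 1) h) (map_mem_comap_toBase comm hπ hπ' hK)) := by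
  refine isBaseChange_of_exact (f := mulPIdeal hπ K) (f' := mulPIdeal hπ' K')
    (g := idealMap (toBase N hπ) (I := K.comap (toBase N hπ)) (I' := K) fun _ hx => hx)
    (g' := idealMap (toBase N hπ') (I := K'.comap (toBase N hπ')) (I' := K') fun _ hx => hx)
    ?_ ?_ ih hK_base (exact_mulPIdeal_idealMap hπ K) ?_ (exact_mulPIdeal_idealMap hπ' K') ?_
  · refine LinearMap.ext (Ideal.Quotient.mk_surjective.forall.2 fun a => Subtype.ext ?_)
    exact congrArg (Ideal.Quotient.mk _) ((map_mul h _ a).trans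
      (congrArg (· * h a) (map_natCast h p)))
  · exact LinearMap.ext fun x => Subtype.ext (toBase_map (N := N) comm hπ hπ' x.1).symm
  · rintro ⟨y, hy⟩
    obtain ⟨x, rfl⟩ := toBase_surjective (N := N) hπ hπs y
    exact ⟨⟨x, hy⟩, rfl⟩
  · exact fun x y hxy => mulP_injective hp (congrArg Subtype.val hxy)

include comm hπ hπ' in
theorem isBaseChange_map (hπs : Function.Surjective π) (hp : IsLeftRegular (p : A'))
    (hk : IsBaseChange S k.toLinearMap) (N : ℕ) : IsBaseChange S (map p N h).toLinearMap := by
  induction N with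
  | zero =>
    exact ⟨Function.injective_of_subsingleton _, fun _ => ⟨0, Subsingleton.elim _ _⟩⟩
  | succ N ih =>
    exact isBaseChange_idealMap_top_iff.1 (isBaseChange_idealMap_succ (K := ⊤) (K' := ⊤) comm hπ hπ'
      (fun _ _ => trivial) hπs hp (isBaseChange_idealMap_top_iff.2 hk) ih)

end BaseChange

end ModPow
end ModPow

section Witt

open WittVector

variable {p : ℕ} [Fact p.Prime]

section

variable {P : Type*} [CommRing P] [IsFpAlgebra p P]

theorem wittVector_ker_constantCoeff [PerfectRing P p] :
    RingHom.ker (constantCoeff : WittVector p P →+* P) = Ideal.span {(p : WittVector p P)} := by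
  refine le_antisymm (fun x (hx : WittVector.coeff x 0 = 0) => ?_) ?_
  · obtain ⟨w, hw, -⟩ := exists_eq_teichmuller_add_mul x
    rw [hx, teichmuller_zero, zero_add] at hw
    exact Ideal.mem_span_singleton.2 ⟨w, hw⟩
  · rw [Ideal.span_singleton_le_iff_mem]
    exact natCast_mem_wittIdeal (RingHom.id P)

theorem exact_natCast_mul_constantCoeff [PerfectRing P p] :
    Function.Exact (fun x : WittVector p P => p * x) constantCoeff := fun x => by
  rw [← RingHom.mem_ker, wittVector_ker_constantCoeff, Ideal.mem_span_singleton']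
  simp only [mul_comm, Set.mem_range]

theorem wittVector_isLeftRegular_natCast [PerfectRing P p] :
    IsLeftRegular (p : WittVector p P) := fun x y hxy => by
  rcases subsingleton_or_nontrivial P
  · exact WittVector.ext fun _ => Subsingleton.elim _ _
  have := IsFpAlgebra.charP (p := p) (R := P)
  refine WittVector.ext fun j => (perfectFrobenius p P).injective ?_
  rw [perfectFrobenius_apply, perfectFrobenius_apply, ← mul_charP_coeff_succ,
    ← mul_charP_coeff_succ, mul_comm, mul_comm y]
  exact congrArg (fun z : WittVector p P => z.coeff (j + 1)) hxy

end

/-- A `B`-algebra as an algebra over `W(B)`, via the residue homomorphism `W(B) → B`. -/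
abbrev residueAlgebra (B P : Type*) [CommRing B] [CommRing P] [Algebra B P] :
    Algebra (WittVector p B) P :=
  ((algebraMap B P).comp constantCoeff).toAlgebra

attribute [local instance] residueAlgebra

variable {B B' P P' : Type*} [CommRing B] [CommRing B'] [CommRing P] [CommRing P'] [Algebra B B']
  [Algebra B P] [Algebra B P'] [Algebra B' P']

theorem isScalarTower_residueAlgebra : IsScalarTower (WittVector p B) B P :=
  .of_algebraMap_eq' rfl

theorem isScalarTower_wittVector_residueAlgebra [IsScalarTower B B' P'] :
    IsScalarTower (WittVector p B) (WittVector p B') P' :=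
  .of_algebraMap_eq fun x => IsScalarTower.algebraMap_apply B B' P' (x.coeff 0)

theorem isScalarTower_wittVector [IsScalarTower B B' P'] :
    IsScalarTower (WittVector p B) (WittVector p B') (WittVector p P') :=
  .of_algebraMap_eq fun x => WittVector.ext fun n =>
    IsScalarTower.algebraMap_apply B B' P' (x.coeff n)

attribute [local instance] isScalarTower_residueAlgebra isScalarTower_wittVector_residueAlgebra
  isScalarTower_wittVector

variable (p B P) in
/-- The residue homomorphism `W(P) → P` as a homomorphism of `W(B)`-algebras. -/
def residue : WittVector p P →ₐ[WittVector p B] P where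
  toRingHom := constantCoeff
  commutes' _ := rfl

theorem residue_surjective : Function.Surjective (residue p B P) :=
  constantCoeff_surjective p

variable (p) in
/-- Functoriality of the Witt vectors, for homomorphisms of algebras. -/
def wittMap (h : P →ₐ[B] P') : WittVector p P →ₐ[WittVector p B] WittVector p P' where
  toRingHom := WittVector.map h
  commutes' x := WittVector.ext fun n => h.commutes (x.coeff n)

variable [IsFpAlgebra p B] [IsFpAlgebra p B'] [PerfectRing B p] [PerfectRing B' p] in
theorem isPushout_residueAlgebra : Algebra.IsPushout (WittVector p B) (WittVector p B') B B' := by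
  refine ⟨.of_right_exact _ _ _ _
    (f := LinearMap.mulLeft _ (p : WittVector p B)) (g := (residue p B B).toLinearMap)
    (f' := LinearMap.mulLeft _ (p : WittVector p B')) (g' := (residue p B' B').toLinearMap)
    ?_ ?_ (.linearMap _ _) (.linearMap _ _) exact_natCast_mul_constantCoeff
    (constantCoeff_surjective p) exact_natCast_mul_constantCoeff (constantCoeff_surjective p)⟩
  · exact LinearMap.ext fun x => (map_mul (algebraMap (WittVector p B) (WittVector p B')) _ x).trans
      (congrArg (· * _) (map_natCast _ p))
  · rfl

theorem ker_residue [IsFpAlgebra p P] [PerfectRing P p] :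
    RingHom.ker (residue p B P) = Ideal.span {(p : WittVector p P)} :=
  wittVector_ker_constantCoeff

section

variable [IsScalarTower B B' P'] {h : P →ₐ[B] P'}

variable (p B' h) in
theorem residue_wittMap : (h.restrictScalars (WittVector p B)).comp (residue p B P) =
    ((residue p B' P').restrictScalars (WittVector p B)).comp (wittMap p h) := rfl

variable [IsFpAlgebra p P] [IsFpAlgebra p P'] [PerfectRing P p] [PerfectRing P' p]

theorem modPow_wittMap_mem_comap_toBase {K : Ideal P} {K' : Ideal P'} (hK : ∀ x ∈ K, h x ∈ K')
    (N : ℕ) : ∀ x ∈ K.comap (ModPow.toBase N (ker_residue (p := p) (B := B))),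
      ModPow.map p (N + 1) (wittMap p h) x ∈
        K'.comap (ModPow.toBase N (ker_residue (p := p) (B := B'))) :=
  ModPow.map_mem_comap_toBase (residue_wittMap p B' h) ker_residue ker_residue hK

variable [IsFpAlgebra p B] [IsFpAlgebra p B'] [PerfectRing B p] [PerfectRing B' p]

theorem isBaseChange_modPow_wittMap (hh : IsBaseChange B' h.toLinearMap) (N : ℕ) :
    IsBaseChange (WittVector p B') (ModPow.map p N (wittMap p h)).toLinearMap := by
  have := isPushout_residueAlgebra (p := p) (B := B) (B' := B')
  have hh' : IsBaseChange (WittVector p B')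
      (h.toLinearMap.restrictScalars (WittVector p B)) :=
    isBaseChange_restrictScalars_of_isPushout hh
  exact ModPow.isBaseChange_map (residue_wittMap p B' h) ker_residue ker_residue residue_surjective
    wittVector_isLeftRegular_natCast hh' N

theorem isBaseChange_idealMap_modPow_wittMap (hh : IsBaseChange B' h.toLinearMap) {K : Ideal P}
    {K' : Ideal P'} {hK : ∀ x ∈ K, h x ∈ K'} (hhK : IsBaseChange B' (idealMap h hK)) (N : ℕ) :
    IsBaseChange (WittVector p B') (idealMap (ModPow.map p (N + 1) (wittMap p h))
      (modPow_wittMap_mem_comap_toBase (B' := B') hK N)) := by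
  have := isPushout_residueAlgebra (p := p) (B := B) (B' := B')
  have hhK' : IsBaseChange (WittVector p B')
      ((idealMap h hK).restrictScalars (WittVector p B)) :=
    isBaseChange_restrictScalars_of_isPushout hhK
  exact ModPow.isBaseChange_idealMap_succ (residue_wittMap p B' h) ker_residue ker_residue hK
    residue_surjective wittVector_isLeftRegular_natCast hhK' (isBaseChange_modPow_wittMap hh N)

end

end Witt

/-! ### Flat base change of PD hulls -/

section PDHullBaseChange

variable {O O' A A' T : Type*} [CommRing O] [CommRing O'] [CommRing A] [CommRing A'] [CommRing T]
  [Algebra O O'] [Algebra O A] [Algebra O A'] [Algebra O' A'] [IsScalarTower O O' A']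
  {h : A →ₐ[O] A'}

theorem exists_ringHom_of_isBaseChange (hA : IsBaseChange O' h.toLinearMap) {φ : A →+* T}
    {σ : O' →+* T} (hσ : σ.comp (algebraMap O O') = φ.comp (algebraMap O A)) :
    ∃ τ : A' →+* T, τ.comp h = φ ∧ τ.comp (algebraMap O' A') = σ := by
  let := h.toRingHom.toAlgebra
  let := (φ.comp (algebraMap O A)).toAlgebra
  have : IsScalarTower O A A' := .of_algebraMap_eq' h.comp_algebraMap.symm
  have : Algebra.IsPushout O O' A A' := ⟨hA⟩
  let σ' : O' →ₐ[O] T := { σ with commutes' := RingHom.congr_fun hσ }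
  let φ' : A →ₐ[O] T := { φ with commutes' := fun _ => rfl }
  have hcomm (x : O') (y : A) : σ' x * φ' y = φ' y * σ' x := mul_comm _ _
  exact ⟨Algebra.pushoutDesc A' σ' φ' hcomm, RingHom.ext (Algebra.pushoutDesc_right A' σ' φ' hcomm),
    RingHom.ext (Algebra.pushoutDesc_left A' σ' φ' hcomm)⟩

theorem ringHom_ext_of_isBaseChange (hA : IsBaseChange O' h.toLinearMap) {τ₁ τ₂ : A' →+* T}
    (hh : τ₁.comp h = τ₂.comp (h : A →+* A'))
    (hσ : τ₁.comp (algebraMap O' A') = τ₂.comp (algebraMap O' A')) : τ₁ = τ₂ := by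
  ext a'
  induction a' using hA.inductionOn with
  | zero => rw [map_zero, map_zero]
  | tmul a => exact RingHom.congr_fun hh a
  | smul s a' ih =>
    rw [Algebra.smul_def, map_mul, map_mul, ih]
    exact congrArg (· * τ₂ a') (RingHom.congr_fun hσ s)
  | add a' b' iha ihb => rw [map_add, map_add, iha, ihb]

theorem exists_semilinearMap_of_isBaseChange {M M' Q : Type*} [AddCommMonoid M] [AddCommMonoid M']
    [AddCommMonoid Q] [Module O M] [Module A M] [IsScalarTower O A M] [Module O M'] [Module O' M']
    [Module A' M'] [IsScalarTower O O' M'] [IsScalarTower O' A' M'] [Module T Q]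
    {g : M →ₗ[O] M'} (hg : ∀ (a : A) (x : M), g (a • x) = h a • g x)
    (hA : IsBaseChange O' h.toLinearMap) (hM : IsBaseChange O' g) {φ : A →+* T} {τ : A' →+* T}
    (hτ : τ.comp h = φ) (E : M →ₛₗ[φ] Q) : ∃ E' : M' →ₛₗ[τ] Q, ∀ x, E' (g x) = E x := by
  subst hτ
  let := Module.compHom Q (τ.comp (algebraMap O' A'))
  let := Module.compHom Q ((τ.comp (algebraMap O' A')).comp (algebraMap O O'))
  have : IsScalarTower O O' Q := .of_algebraMap_smul fun _ _ => rfl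
  let E₀ : M →ₗ[O] Q :=
    { toFun := E
      map_add' := map_add E
      map_smul' := fun s x => by
        rw [← algebraMap_smul A s x, map_smulₛₗ]
        exact congrArg (fun t => τ t • E x)
          ((h.commutes s).trans (IsScalarTower.algebraMap_apply O O' A' s)) }
  let E' := hM.lift E₀
  refine ⟨{ E' with map_smul' := fun a' x' => ?_ }, fun x => hM.lift_eq E₀ x⟩
  change E' (a' • x') = τ a' • E' x'
  induction a' using hA.inductionOn with
  | zero => rw [zero_smul, map_zero, map_zero, zero_smul]
  | add a' b' iha ihb => rw [add_smul, map_add, iha, ihb, map_add, add_smul]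
  | smul s a' ih =>
    rw [smul_assoc, map_smul, ih, Algebra.smul_def, map_mul, mul_smul]
    rfl
  | tmul a =>
    induction x' using hM.inductionOn with
    | zero => rw [smul_zero, map_zero, smul_zero]
    | add x' y' ihx ihy => rw [smul_add, map_add, ihx, ihy, map_add, smul_add]
    | smul s x' ih =>
      rw [smul_comm, map_smul, ih, map_smul]
      exact smul_comm (τ _) (τ _) (E' x')
    | tmul x =>
      have hE' (y : M) : E' (g y) = E y := hM.lift_eq E₀ y
      exact (congrArg E' (hg a x)).symm.trans <| by
        rw [hE', map_smulₛₗ, hE']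
        rfl

namespace PDHull

variable {p : ℕ} {I : Ideal A} {I' : Ideal A'} {hI : ∀ x ∈ I, h x ∈ I'}

theorem span_range_idealMap_eq_top (hIb : IsBaseChange O' (idealMap h hI)) :
    Submodule.span A' (Set.range fun x : I => (⟨h x, hI x x.2⟩ : I')) = ⊤ := by
  rw [eq_top_iff]
  rintro x' -
  induction x' using hIb.inductionOn with
  | zero => exact Submodule.zero_mem _
  | tmul x => exact Submodule.subset_span ⟨x, rfl⟩
  | smul s x' ih => exact Submodule.smul_of_tower_mem _ s ih
  | add x' y' ihx ihy => exact Submodule.add_mem _ ihx ihy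

theorem existsUnique_of_isBaseChange (hpI : (p : A) ∈ I) (hA : IsBaseChange O' h.toLinearMap)
    (hIb : IsBaseChange O' (idealMap h hI)) {ψ : PDHull p I →+* T} {σ : O' →+* T}
    (hσ : σ.comp (algebraMap O O') = (ψ.comp (of p I)).comp (algebraMap O A)) :
    ∃! ψ' : PDHull p I' →+* T, ψ'.comp (map p (h : A →+* A') hI) = ψ ∧
      (ψ'.comp (of p I')).comp (algebraMap O' A') = σ := by
  have hspan := span_range_idealMap_eq_top hIb
  obtain ⟨τ, hτ, hτσ⟩ := exists_ringHom_of_isBaseChange hA hσ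
  have hg (a : A) (x : I) : idealMap h hI (a • x) = h a • idealMap h hI x :=
    Subtype.ext (map_mul h a x)
  obtain ⟨E', hE'⟩ := exists_semilinearMap_of_isBaseChange hg hA hIb hτ (expMap ψ)
  obtain ⟨ψ', hψ', hψτ⟩ := exists_comp_map_eq hI hpI hspan hτ hE'
  refine ⟨ψ', ⟨hψ', hψτ ▸ hτσ⟩, fun ψ'' ⟨hψ'', hψσ⟩ => ?_⟩
  have hmap := hψ''.trans hψ'.symm
  refine ringHom_ext_of_span hspan hmap (ringHom_ext_of_isBaseChange hA (RingHom.ext fun a => ?_)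
    (hψσ.trans (hψτ ▸ hτσ).symm))
  have hof (χ : PDHull p I' →+* T) : χ (map p (h : A →+* A') hI (of p I a)) = χ (of p I' (h a)) :=
    congrArg χ (map_of p _ hI a)
  exact (hof ψ'').symm.trans ((RingHom.congr_fun hmap (of p I a)).trans (hof ψ'))

end PDHull

end PDHullBaseChange

section PerfectBaseChange

variable {p : ℕ} [Fact p.Prime] {B B' P P' : Type*} [CommRing B] [CommRing B'] [CommRing P]
  [CommRing P'] [Algebra B B'] [Algebra B P] [Algebra B P'] [Algebra B' P'] [IsScalarTower B B' P']
  [IsFpAlgebra p B] [IsFpAlgebra p B'] [IsFpAlgebra p P] [IsFpAlgebra p P'] [PerfectRing B p]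
  [PerfectRing B' p] [PerfectRing P p] {h : P →ₐ[B] P'}

theorem perfectFrobenius_symm_pow {R : Type*} [CommRing R] [IsFpAlgebra p R] [PerfectRing R p]
    (x : R) : (perfectFrobenius p R).symm x ^ p = x :=
  (perfectFrobenius p R).apply_symm_apply x

theorem map_perfectFrobenius_symm {R S : Type*} [CommRing R] [CommRing S] [IsFpAlgebra p R]
    [IsFpAlgebra p S] [PerfectRing R p] [PerfectRing S p] (f : R →+* S) (x : R) :
    f ((perfectFrobenius p R).symm x) = (perfectFrobenius p S).symm (f x) := by
  rw [RingEquiv.eq_symm_apply, perfectFrobenius_apply, ← map_pow, perfectFrobenius_symm_pow]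

theorem perfectRing_of_isBaseChange (hh : IsBaseChange B' h.toLinearMap) : PerfectRing P' p := by
  obtain ⟨τ, hτh, hτσ⟩ := exists_ringHom_of_isBaseChange hh
    (φ := (h : P →+* P').comp (perfectFrobenius p P).symm.toRingHom)
    (σ := (algebraMap B' P').comp (perfectFrobenius p B').symm.toRingHom) <| RingHom.ext fun b => by
      change algebraMap B' P' ((perfectFrobenius p B').symm (algebraMap B B' b)) =
        h ((perfectFrobenius p P).symm (algebraMap B P b))
      rw [← map_perfectFrobenius_symm, ← map_perfectFrobenius_symm, h.commutes,
        ← IsScalarTower.algebraMap_apply]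
  have hτ (x : P') : τ x ^ p = x := by
    induction x using hh.inductionOn with
    | zero => rw [map_zero, zero_pow (Nat.Prime.ne_zero Fact.out)]
    | tmul a =>
      have : τ (h a) = h ((perfectFrobenius p P).symm a) := RingHom.congr_fun hτh a
      rw [AlgHom.toLinearMap_apply, this, ← map_pow, perfectFrobenius_symm_pow]
    | smul s x ih =>
      have : τ (algebraMap B' P' s) = algebraMap B' P' ((perfectFrobenius p B').symm s) :=
        RingHom.congr_fun hτσ s
      rw [Algebra.smul_def, map_mul, mul_pow, ih, this, ← map_pow, perfectFrobenius_symm_pow]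
    | add x y hx hy => rw [map_add, IsFpAlgebra.add_pow p, hx, hy]
  refine ⟨Function.bijective_iff_has_inverse.2 ⟨τ, fun x => ?_, hτ⟩⟩
  exact (map_pow τ x p).trans (hτ x)

theorem surjective_of_isBaseChange {C C' : Type*} [CommRing C] [CommRing C'] [Algebra B C]
    [Algebra B C'] [Algebra B' C'] [IsScalarTower B B' C'] {k : C →ₐ[B] C'} {π : P →ₐ[B] C}
    {π' : P' →ₐ[B'] C'} (comm : k.comp π = (π'.restrictScalars B).comp h)
    (hk : IsBaseChange B' k.toLinearMap) (hπ : Function.Surjective π) :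
    Function.Surjective π' := fun c => by
  change c ∈ π'.range
  induction c using hk.inductionOn with
  | zero => exact zero_mem _
  | tmul c =>
    obtain ⟨a, rfl⟩ := hπ c
    exact ⟨h a, (AlgHom.congr_fun comm a).symm⟩
  | smul s c hc => exact Subalgebra.smul_mem _ hc s
  | add c d hc hd => exact add_mem hc hd

end PerfectBaseChange

section WittBaseChange

open WittVector

variable {p : ℕ} [Fact p.Prime]

attribute [local instance] residueAlgebra isScalarTower_residueAlgebra
  isScalarTower_wittVector_residueAlgebra isScalarTower_wittVector

variable {B P C R : Type*} [CommRing B] [CommRing P] [CommRing C] [CommRing R] [Algebra B P]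
  [Algebra B C] [IsFpAlgebra p P] [PerfectRing P p] {n : ℕ}

theorem mk_mem_comap_toBase (π : P →ₐ[B] C) (n : ℕ) :
    ∀ x ∈ wittIdeal p (π : P →+* C), Ideal.Quotient.mk _ x ∈
      (RingHom.ker π).comap (ModPow.toBase n (ker_residue (p := p) (B := B))) :=
  fun _ hx => hx

variable [IsFpAlgebra p C]

theorem bijective_comp_map_modPow (hR : (p : R) ^ n = 0) (π : P →ₐ[B] C) :
    Function.Bijective fun χ : PDHull p ((RingHom.ker π).comap
        (ModPow.toBase n (ker_residue (p := p) (B := B)))) →+* R =>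
      χ.comp (PDHull.map p (Ideal.Quotient.mk _) (mk_mem_comap_toBase π n)) := by
  have hpI := natCast_mem_wittIdeal (p := p) (π : P →+* C)
  refine ⟨fun χ₁ χ₂ => ?_, fun ψ => ?_⟩
  · exact PDHull.ringHom_ext_of_surjective _ Ideal.Quotient.mk_surjective le_rfl
  · exact PDHull.exists_comp_map_eq_of_surjective _ hpI Ideal.Quotient.mk_surjective le_rfl
      fun x hx => PDHull.expMap_eq_zero_of_pow_dvd hR ψ hpI (ModPow.mk_eq_zero_iff.1 hx)

variable {B' P' C' : Type*} [CommRing B'] [CommRing P'] [CommRing C'] [Algebra B B'] [Algebra B P']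
  [Algebra B' P'] [IsScalarTower B B' P'] [Algebra B C'] [Algebra B' C'] [IsScalarTower B B' C']
  [IsFpAlgebra p B] [IsFpAlgebra p B'] [IsFpAlgebra p P'] [PerfectRing B p] [PerfectRing B' p]
  [PerfectRing P' p] [IsFpAlgebra p C'] {h : P →ₐ[B] P'} {k : C →ₐ[B] C'} {π : P →ₐ[B] C}
  {π' : P' →ₐ[B'] C'}

theorem existsUnique_wittIdeal_of_isBaseChange [Module.Flat B B'] (hR : (p : R) ^ n = 0)
    (comm : k.comp π = (π'.restrictScalars B).comp h) (hh : IsBaseChange B' h.toLinearMap)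
    (hk : IsBaseChange B' k.toLinearMap) {ψ : PDHull p (wittIdeal p (π : P →+* C)) →+* R}
    {σ : WittVector p B' →+* R} (hσ : σ.comp (algebraMap (WittVector p B) (WittVector p B')) =
      (ψ.comp (PDHull.of p _)).comp (algebraMap (WittVector p B) (WittVector p P)))
    (hI : ∀ x ∈ wittIdeal p (π : P →+* C),
      WittVector.map (h : P →+* P') x ∈ wittIdeal p (π' : P' →+* C')) :
    ∃! ψ' : PDHull p (wittIdeal p (π' : P' →+* C')) →+* R,
      ψ'.comp (PDHull.map p (WittVector.map (h : P →+* P')) hI) = ψ ∧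
        (ψ'.comp (PDHull.of p _)).comp (algebraMap (WittVector p B') (WittVector p P')) = σ := by
  have hker : ∀ x ∈ RingHom.ker π, h x ∈ RingHom.ker π' := fun x (hx : π x = 0) =>
    (AlgHom.congr_fun comm x).symm.trans ((congrArg k hx).trans (map_zero k))
  obtain ⟨χ, rfl⟩ := (bijective_comp_map_modPow hR π).2 ψ
  have hpI : (p : ModPow p (n + 1) (WittVector p P)) ∈
      (RingHom.ker π).comap (ModPow.toBase n (ker_residue (p := p) (B := B))) := by
    rw [Ideal.mem_comap, map_natCast, RingHom.mem_ker, map_natCast, IsFpAlgebra.natCast_eq_zero]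
  have hσχ : σ.comp (algebraMap (WittVector p B) (WittVector p B')) =
      (χ.comp (PDHull.of p _)).comp (algebraMap (WittVector p B) (ModPow p (n + 1) _)) :=
    hσ.trans (by dsimp only; rw [PDHull.comp_map_comp_of]; rfl)
  have key := PDHull.existsUnique_of_isBaseChange hpI (isBaseChange_modPow_wittMap hh (n + 1))
    (isBaseChange_idealMap_modPow_wittMap hh (isBaseChange_idealMap_ker comm hh hk hker) n) hσχ
  have hcomp (χ' : PDHull p ((RingHom.ker π').comap
      (ModPow.toBase n (ker_residue (p := p) (B := B')))) →+* R) :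
      (χ'.comp (PDHull.map p _ (modPow_wittMap_mem_comap_toBase hker n))).comp
        (PDHull.map p _ (mk_mem_comap_toBase π n)) =
      (χ'.comp (PDHull.map p _ (mk_mem_comap_toBase π' n))).comp (PDHull.map p _ hI) :=
    congrArg χ'.comp <|
      (PDHull.map_comp_map (mk_mem_comap_toBase π n) (modPow_wittMap_mem_comap_toBase hker n)).trans
        (PDHull.map_comp_map hI (mk_mem_comap_toBase π' n)).symm
  refine (bijective_comp_map_modPow hR π').existsUnique_iff.2
    ((existsUnique_congr fun χ' => and_congr ?_ ?_).1 key)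
  · exact (bijective_comp_map_modPow hR π).1.eq_iff.symm.trans (by rw [← hcomp]; rfl)
  · rw [PDHull.comp_map_comp_of]
    rfl

variable {Q : Type*} [CommRing Q] [IsFpAlgebra p Q] [PerfectRing Q p]

theorem existsUnique_wittIdeal_of_perfect [Module.Flat B B'] (hR : (p : R) ^ n = 0)
    (comm : k.comp π = (π'.restrictScalars B).comp h) (hh : IsBaseChange B' h.toLinearMap)
    (hk : IsBaseChange B' k.toLinearMap) (hπ : Function.Surjective π)
    {ψ : PDHull p (wittIdeal p (π : P →+* C)) →+* R} {σ : WittVector p B' →+* R}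
    (hσ : σ.comp (algebraMap (WittVector p B) (WittVector p B')) =
      (ψ.comp (PDHull.of p _)).comp (algebraMap (WittVector p B) (WittVector p P)))
    {ρ : Q →+* C'} {g : P' →+* Q} (hg : ρ.comp g = π') {f : P →+* Q} (hf : g.comp h = f)
    {u : B' →+* Q} (hu : g.comp (algebraMap B' P') = u)
    (hI : ∀ x ∈ wittIdeal p (π : P →+* C), WittVector.map f x ∈ wittIdeal p ρ) :
    ∃! ψ' : PDHull p (wittIdeal p ρ) →+* R,
      ψ'.comp (PDHull.map p (WittVector.map f) hI) = ψ ∧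
        (ψ'.comp (PDHull.of p _)).comp (WittVector.map u) = σ := by
  subst hf hu
  have hI' : ∀ x ∈ wittIdeal p (π : P →+* C),
      WittVector.map (h : P →+* P') x ∈ wittIdeal p (π' : P' →+* C') := fun x hx => by
    rw [← hg]
    exact hI x hx
  have hbij := bijective_comp_map_of_perfect hR hg (surjective_of_isBaseChange comm hk hπ)
  refine (existsUnique_congr fun ψ' => and_congr ?_ ?_).1
    (hbij.existsUnique_iff.1 (existsUnique_wittIdeal_of_isBaseChange hR comm hh hk hσ hI'))
  · rw [RingHom.comp_assoc, PDHull.map_comp_map]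
    rfl
  · rw [PDHull.comp_map_comp_of]
    rfl

end WittBaseChange

/-! ### Comparison of the completions -/

namespace Fontainization

variable {p : ℕ} [Fact p.Prime] {C : Type*} [CommRing C] [IsFpAlgebra p C]

instance : IsFpAlgebra p (Fontainization p C) where
  natCast_eq_zero := Subtype.ext (funext fun _ => IsFpAlgebra.natCast_eq_zero)

instance : PerfectRing (Fontainization p C) p where
  bijective_frobenius := by
    refine ⟨fun x y h => Subtype.ext (funext fun n => ?_), fun x => ?_⟩
    · rw [← x.2 n, ← y.2 n]
      exact congrFun (congrArg Subtype.val h) (n + 1)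
    · exact ⟨⟨fun n => x.1 (n + 1), fun n => x.2 (n + 1)⟩, Subtype.ext (funext x.2)⟩

theorem proj_pow (k : ℕ) (x : Fontainization p C) : proj p C k x ^ p ^ k = proj p C 0 x := by
  induction k with
  | zero => rw [pow_zero, pow_one]
  | succ k ih => rw [pow_succ', pow_mul, show proj p C (k + 1) x ^ p = proj p C k x from x.2 k, ih]

theorem proj_zero_surjective [IsSemiperfect p C] : Function.Surjective (proj p C 0) := fun c => by
  choose r hr using IsSemiperfect.surjective_frobenius (p := p) (R := C)
  refine ⟨⟨fun n => r^[n] c, fun n => ?_⟩, rfl⟩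
  exact (congrArg (· ^ p) (Function.iterate_succ_apply' r n c)).trans (hr _)

theorem lift_proj_zero : lift p (proj p C 0) = RingHom.id (Fontainization p C) := by
  ext x n
  change proj p C 0 (((perfectFrobenius p _)⁻¹ ^ n) x) = proj p C n x
  rw [← proj_pow n, ← map_pow, perfectFrobenius_inv_pow_apply_pow]

theorem lift_comp_eq_map {P D : Type*} [CommRing P] [CommRing D] [IsFpAlgebra p P]
    [IsFpAlgebra p D] [PerfectRing P p] {π : P →+* D} {h : Fontainization p C →+* P} {k : C →+* D}
    (comm : π.comp h = k.comp (proj p C 0)) : (lift p π).comp h = map p k := by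
  rw [lift_comp, comm, ← map_comp_lift, lift_proj_zero, RingHom.comp_id]

end Fontainization

namespace PCompletion

variable {p : ℕ} {R S Q : Type*} [CommRing R] [CommRing S] [CommRing Q]

theorem natCast_pow_quotient_eq_zero {n : ℕ} :
    (p : R ⧸ Ideal.span {(p : R)} ^ n) ^ n = 0 := by
  rw [← map_natCast (Ideal.Quotient.mk (Ideal.span {(p : R)} ^ n)), ← map_pow]
  exact Ideal.Quotient.eq_zero_iff_mem.2 (Ideal.pow_mem_pow (Ideal.mem_span_singleton_self _) n)

theorem exists_eq_of_add_pow_mul (n : ℕ) (x : PCompletion p R) :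
    ∃ (r : R) (y : PCompletion p R), x = of p R r + (p : PCompletion p R) ^ n * y := by
  obtain ⟨r, hr⟩ := Ideal.Quotient.mk_surjective (AdicCompletion.evalₐ (Ideal.span {(p : R)}) n x)
  have hx : x - of p R r ∈ (AdicCompletion.eval (Ideal.span {(p : R)}) R n).ker := by
    have h0 : AdicCompletion.evalₐ (Ideal.span {(p : R)}) n (x - of p R r) = 0 := by
      rw [map_sub, ← hr, sub_eq_zero]
      rfl
    rw [LinearMap.mem_ker, ← AdicCompletion.factor_evalₐ_eq_eval _ _ (Ideal.mul_top _).ge, h0,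
      map_zero]
  rw [← AdicCompletion.pow_smul_top_eq_ker_eval (Submodule.fg_span_singleton _),
    Ideal.span_singleton_pow, Submodule.ideal_span_singleton_smul] at hx
  obtain ⟨y, -, hy⟩ := (Submodule.mem_smul_pointwise_iff_exists _ _ _).1 hx
  rw [Algebra.smul_def, map_pow, map_natCast] at hy
  exact ⟨r, y, sub_eq_iff_eq_add'.1 hy.symm⟩

theorem ringHom_ext_of_pow_eq_zero {n : ℕ} (hQ : (p : Q) ^ n = 0) {f g : PCompletion p R →+* Q}
    (h : f.comp (of p R) = g.comp (of p R)) : f = g := RingHom.ext fun x => by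
  obtain ⟨r, y, rfl⟩ := exists_eq_of_add_pow_mul n x
  have hr : f (of p R r) = g (of p R r) := RingHom.congr_fun h r
  simp only [map_add, map_mul, map_pow, map_natCast, hQ, zero_mul, hr]

theorem evalₐ_lift (g : R →+* PCompletion p S) (n : ℕ) (x : PCompletion p R) :
    AdicCompletion.evalₐ (Ideal.span {(p : S)}) n (lift p g x) =
      liftAux p g n (AdicCompletion.evalₐ (Ideal.span {(p : R)}) n x) :=
  AdicCompletion.evalₐ_liftRingHom _ _ (factorPow_comp_liftAux p g) n x

theorem liftAux_factorPow (g : R →+* PCompletion p S) {m n : ℕ} (hle : m ≤ n)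
    (q : R ⧸ Ideal.span {(p : R)} ^ n) :
    liftAux p g m (Ideal.Quotient.factorPow _ hle q) =
      Ideal.Quotient.factorPow _ hle (liftAux p g n q) := by
  obtain ⟨r, rfl⟩ := Ideal.Quotient.mk_surjective q
  exact (factorPow_evalₐ _ hle (g r)).symm

theorem lift_bijective (g : R →+* PCompletion p S)
    (hg : ∀ n, Function.Bijective (liftAux p g n)) : Function.Bijective (lift p g) := by
  refine ⟨fun x y hxy => AdicCompletion.ext_evalₐ fun n => (hg n).1 ?_, fun y => ?_⟩
  · rw [← evalₐ_lift, ← evalₐ_lift, hxy]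
  · let e (n : ℕ) := RingEquiv.ofBijective _ (hg n)
    have he (n : ℕ) (z) : liftAux p g n ((e n).symm z) = z := (e n).apply_symm_apply z
    let f (n : ℕ) : PCompletion p S →+* R ⧸ Ideal.span {(p : R)} ^ n :=
      ((e n).symm : _ →+* _).comp (AdicCompletion.evalₐ _ n).toRingHom
    have hf {m n : ℕ} (hle : m ≤ n) : (Ideal.Quotient.factorPow _ hle).comp (f n) = f m := by
      refine RingHom.ext fun z => (hg m).1 ?_
      change liftAux p g m (Ideal.Quotient.factorPow _ hle
        ((e n).symm (AdicCompletion.evalₐ _ n z))) =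
          liftAux p g m ((e m).symm (AdicCompletion.evalₐ _ m z))
      rw [liftAux_factorPow, he, he, factorPow_evalₐ]
    refine ⟨AdicCompletion.liftRingHom _ f hf y, AdicCompletion.ext_evalₐ fun n => ?_⟩
    rw [evalₐ_lift, AdicCompletion.evalₐ_liftRingHom]
    exact he n _

theorem exists_comp_quotientMk_eq {n : ℕ} (hQ : (p : Q) ^ n = 0) (f : R →+* Q) :
    ∃ f' : R ⧸ Ideal.span {(p : R)} ^ n →+* Q, f'.comp (Ideal.Quotient.mk _) = f := by
  refine ⟨Ideal.Quotient.lift _ f fun x hx => ?_, RingHom.ext fun _ => rfl⟩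
  rw [Ideal.span_singleton_pow, Ideal.mem_span_singleton'] at hx
  obtain ⟨y, rfl⟩ := hx
  rw [map_mul, map_pow, map_natCast, hQ, mul_zero]

end PCompletion

namespace Acris

open Algebra.TensorProduct (includeLeft includeLeftRingHom includeRight)

variable {p : ℕ} [Fact p.Prime] {B B' C D Q : Type*} [CommRing B] [CommRing B'] [CommRing C]
  [CommRing D] [CommRing Q] [IsFpAlgebra p B] [IsFpAlgebra p B'] [IsFpAlgebra p C]
  [IsFpAlgebra p D] [PerfectRing B p] [PerfectRing B' p] [Algebra B B'] [Algebra B C] {n : ℕ}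

/-- The canonical homomorphism to `A_cris(C)` from the PD hull of which it is the completion. -/
def ofPDHull (p : ℕ) [Fact p.Prime] (C : Type*) [CommRing C] [IsFpAlgebra p C] :
    PDHull p (RingHom.ker (wittToBase p C)) →+* Acris p C :=
  PCompletion.of p _

/-- Functoriality of the PD hull of `W(C♭) ↠ C`. -/
def pdHullMap (p : ℕ) [Fact p.Prime] [IsFpAlgebra p C] [IsFpAlgebra p D] (f : C →+* D) :
    PDHull p (RingHom.ker (wittToBase p C)) →+* PDHull p (RingHom.ker (wittToBase p D)) :=
  PDHull.map p (WittVector.map (Fontainization.map p f))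
    fun _ hx => (congrArg f hx).trans (map_zero f)

/-- The homomorphism from `W(B)` to the PD hull of `W(C♭) ↠ C` induced by a homomorphism `B → C`,
where `B` is perfect. -/
def pdHullBase (p : ℕ) [Fact p.Prime] [IsFpAlgebra p B] [IsFpAlgebra p C] [PerfectRing B p]
    (φ : B →+* C) : WittVector p B →+* PDHull p (RingHom.ker (wittToBase p C)) :=
  (PDHull.of p _).comp (WittVector.map (Fontainization.lift p φ))

theorem map_comp_ofPDHull (f : C →+* D) :
    (map p f).comp (ofPDHull p C) = (ofPDHull p D).comp (pdHullMap p f) :=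
  RingHom.ext (PCompletion.map_of p (pdHullMap p f))

omit [IsFpAlgebra p B'] [PerfectRing B' p] in
theorem tensor_ringHom_ext (hQ : (p : Q) ^ n = 0)
    {f g : Acris p C ⊗[WittVector p B] WittVector p B' →+* Q}
    (hleft : (f.comp includeLeftRingHom).comp (ofPDHull p C) =
      (g.comp includeLeftRingHom).comp (ofPDHull p C))
    (hright : f.comp (includeRight :
        WittVector p B' →ₐ[WittVector p B] _).toRingHom =
      g.comp (includeRight :
        WittVector p B' →ₐ[WittVector p B] _).toRingHom) : f = g :=
  Algebra.TensorProduct.ringHom_ext (PCompletion.ringHom_ext_of_pow_eq_zero hQ hleft) hright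

theorem existsUnique_pdHull_of_isBaseChange [IsSemiperfect p C] [Module.Flat B B']
    [Algebra B D] [Algebra B' D] [IsScalarTower B B' D] {k : C →ₐ[B] D}
    (hk : IsBaseChange B' k.toLinearMap) (hQ : (p : Q) ^ n = 0)
    {ρ : PDHull p (RingHom.ker (wittToBase p C)) →+* Q} {σ : WittVector p B' →+* Q}
    (hσ : σ.comp (algebraMap (WittVector p B) (WittVector p B')) =
      ρ.comp (pdHullBase p (algebraMap B C))) :
    ∃! ψ : PDHull p (RingHom.ker (wittToBase p D)) →+* Q,
      ψ.comp (pdHullMap p k.toRingHom) = ρ ∧ ψ.comp (pdHullBase p (algebraMap B' D)) = σ := by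
  let _ : Algebra B (Fontainization p C) := (Fontainization.lift p (algebraMap B C)).toAlgebra
  let π : Fontainization p C →ₐ[B] C :=
    { Fontainization.proj p C 0 with commutes' := fun _ => rfl }
  let h : Fontainization p C →ₐ[B] B' ⊗[B] Fontainization p C := includeRight
  let π' : B' ⊗[B] Fontainization p C →ₐ[B'] D :=
    Algebra.TensorProduct.lift (Algebra.ofId B' D) (k.comp π) fun _ _ => Commute.all _ _
  have hh : IsBaseChange B' h.toLinearMap := TensorProduct.isBaseChange B _ B'
  have : PerfectRing (B' ⊗[B] Fontainization p C) p := perfectRing_of_isBaseChange hh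
  have comm : k.comp π = (π'.restrictScalars B).comp h :=
    (Algebra.TensorProduct.lift_comp_includeRight _ _ _).symm
  have hleft : (Fontainization.lift p π'.toRingHom).comp h = Fontainization.map p k.toRingHom :=
    Fontainization.lift_comp_eq_map (congrArg AlgHom.toRingHom comm).symm
  have hright : (Fontainization.lift p π'.toRingHom).comp (algebraMap B' _) =
      Fontainization.lift p (algebraMap B' D) := by
    rw [Fontainization.lift_comp, AlgHom.toRingHom_eq_coe, AlgHom.comp_algebraMap]
  exact existsUnique_wittIdeal_of_perfect (ρ := Fontainization.proj p D 0) hQ comm hh hk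
    Fontainization.proj_zero_surjective hσ rfl hleft hright _

theorem existsUnique_pdHull_tensorProduct [IsSemiperfect p C] [Module.Flat B B']
    (hQ : (p : Q) ^ n = 0) {ρ : PDHull p (RingHom.ker (wittToBase p C)) →+* Q}
    {σ : WittVector p B' →+* Q} (hσ : σ.comp (algebraMap (WittVector p B) (WittVector p B')) =
      ρ.comp (pdHullBase p (algebraMap B C))) :
    ∃! ψ : PDHull p (RingHom.ker (wittToBase p (C ⊗[B] B'))) →+* Q,
      ψ.comp (pdHullMap p (includeLeft : C →ₐ[B] C ⊗[B] B').toRingHom) = ρ ∧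
        ψ.comp (pdHullBase p (includeRight : B' →ₐ[B] C ⊗[B] B').toRingHom) = σ := by
  let _ : Algebra B' (C ⊗[B] B') := Algebra.TensorProduct.rightAlgebra
  have hk : IsBaseChange B' (includeLeft : C →ₐ[B] C ⊗[B] B').toLinearMap :=
    (TensorProduct.isPushout' : Algebra.IsPushout B B' C _).out
  exact existsUnique_pdHull_of_isBaseChange hk hQ hσ

/-- The homomorphism induced by `tensorMap` modulo `p ^ n`. -/
def tensorMapMod (p : ℕ) [Fact p.Prime] (B B' C : Type*) [CommRing B] [CommRing B'] [CommRing C]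
    [IsFpAlgebra p B] [IsFpAlgebra p B'] [IsFpAlgebra p C] [PerfectRing B p] [PerfectRing B' p]
    [Algebra B B'] [Algebra B C] (n : ℕ) :
    (Acris p C ⊗[WittVector p B] WittVector p B') ⧸
        Ideal.span {(p : Acris p C ⊗[WittVector p B] WittVector p B')} ^ n →+*
      PDHull p (RingHom.ker (wittToBase p (C ⊗[B] B'))) ⧸
        Ideal.span {(p : PDHull p (RingHom.ker (wittToBase p (C ⊗[B] B'))))} ^ n :=
  PCompletion.liftAux p (tensorMap p B B' C) n

/-- The homomorphism modulo `p ^ n` from the first factor of `A_cris(C) ⊗_{W(B)} W(B')`, restricted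
to the PD hull of `W(C♭) ↠ C`. -/
def tensorModLeft (p : ℕ) [Fact p.Prime] (B B' C : Type*) [CommRing B] [CommRing B'] [CommRing C]
    [IsFpAlgebra p B] [IsFpAlgebra p C] [PerfectRing B p] [Algebra B B'] [Algebra B C] (n : ℕ) :
    PDHull p (RingHom.ker (wittToBase p C)) →+* (Acris p C ⊗[WittVector p B] WittVector p B') ⧸
      Ideal.span {(p : Acris p C ⊗[WittVector p B] WittVector p B')} ^ n :=
  ((Ideal.Quotient.mk _).comp includeLeftRingHom).comp (ofPDHull p C)

/-- The homomorphism modulo `p ^ n` from the second factor of `A_cris(C) ⊗_{W(B)} W(B')`. -/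
def tensorModRight (p : ℕ) [Fact p.Prime] (B B' C : Type*) [CommRing B] [CommRing B'] [CommRing C]
    [IsFpAlgebra p B] [IsFpAlgebra p C] [PerfectRing B p] [Algebra B B'] [Algebra B C] (n : ℕ) :
    WittVector p B' →+* (Acris p C ⊗[WittVector p B] WittVector p B') ⧸
      Ideal.span {(p : Acris p C ⊗[WittVector p B] WittVector p B')} ^ n :=
  (Ideal.Quotient.mk _).comp (includeRight :
    WittVector p B' →ₐ[WittVector p B] Acris p C ⊗[WittVector p B] WittVector p B').toRingHom

omit [IsFpAlgebra p B'] [PerfectRing B' p] in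
theorem tensorModRight_comp_algebraMap :
    (tensorModRight p B B' C n).comp (algebraMap (WittVector p B) (WittVector p B')) =
      (tensorModLeft p B B' C n).comp (pdHullBase p (algebraMap B C)) :=
  RingHom.ext fun x => (congrArg (Ideal.Quotient.mk _)
    (Algebra.TensorProduct.tmul_one_eq_one_tmul (A := Acris p C) (B := WittVector p B') x)).symm

theorem tensorMapMod_comp_tensorModLeft :
    (tensorMapMod p B B' C n).comp (tensorModLeft p B B' C n) = (Ideal.Quotient.mk _).comp
      (pdHullMap p (includeLeft : C →ₐ[B] C ⊗[B] B').toRingHom) := by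
  refine RingHom.ext fun d => ?_
  have hd : tensorMap p B B' C (ofPDHull p C d ⊗ₜ 1) =
      ofPDHull p _ (pdHullMap p (includeLeft : C →ₐ[B] C ⊗[B] B').toRingHom d) := by
    rw [tensorMap_tmul, map_one, mul_one]
    exact RingHom.congr_fun (map_comp_ofPDHull _) d
  exact congrArg (AdicCompletion.evalₐ (Ideal.span {(p : PDHull p _)}) n) hd

theorem tensorMapMod_comp_tensorModRight :
    (tensorMapMod p B B' C n).comp (tensorModRight p B B' C n) = (Ideal.Quotient.mk _).comp
      (pdHullBase p (includeRight : B' →ₐ[B] C ⊗[B] B').toRingHom) := by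
  refine RingHom.ext fun y => ?_
  have hy : tensorMap p B B' C (1 ⊗ₜ y) =
      ofPDHull p _ (pdHullBase p (includeRight : B' →ₐ[B] C ⊗[B] B').toRingHom y) := by
    rw [tensorMap_tmul, map_one, one_mul]
    rfl
  exact congrArg (AdicCompletion.evalₐ (Ideal.span {(p : PDHull p _)}) n) hy

theorem tensorMapMod_bijective [IsSemiperfect p C] [Module.Flat B B'] :
    Function.Bijective (tensorMapMod p B B' C n) := by
  obtain ⟨ψ, ⟨hψleft, hψright⟩, -⟩ := existsUnique_pdHull_tensorProduct
    PCompletion.natCast_pow_quotient_eq_zero (tensorModRight_comp_algebraMap (p := p)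
      (B := B) (B' := B') (C := C) (n := n))
  obtain ⟨χ, hχ⟩ :=
    PCompletion.exists_comp_quotientMk_eq PCompletion.natCast_pow_quotient_eq_zero ψ
  have hleft := tensorMapMod_comp_tensorModLeft (p := p) (B := B) (B' := B') (C := C) (n := n)
  have hright := tensorMapMod_comp_tensorModRight (p := p) (B := B) (B' := B') (C := C) (n := n)
  have hχ_comp : χ.comp (tensorMapMod p B B' C n) = RingHom.id _ := by
    refine Ideal.Quotient.ringHom_ext (tensor_ringHom_ext
      PCompletion.natCast_pow_quotient_eq_zero ?_ ?_)
    · change χ.comp ((tensorMapMod p B B' C n).comp (tensorModLeft p B B' C n)) = _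
      rw [hleft, ← RingHom.comp_assoc, hχ, hψleft]
      rfl
    · change χ.comp ((tensorMapMod p B B' C n).comp (tensorModRight p B B' C n)) = _
      rw [hright, ← RingHom.comp_assoc, hχ, hψright]
      rfl
  have hcomp_χ : (tensorMapMod p B B' C n).comp χ = RingHom.id _ := by
    refine Ideal.Quotient.ringHom_ext ((congrArg (RingHom.comp (tensorMapMod p B B' C n)) hχ).trans
      ((existsUnique_pdHull_tensorProduct PCompletion.natCast_pow_quotient_eq_zero ?_).unique
        ⟨?_, ?_⟩ ⟨hleft.symm, hright.symm⟩))
    · rw [RingHom.comp_assoc, tensorModRight_comp_algebraMap, RingHom.comp_assoc]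
    · rw [RingHom.comp_assoc, hψleft]
    · rw [RingHom.comp_assoc, hψright]
  exact Function.bijective_iff_has_inverse.2
    ⟨χ, RingHom.congr_fun hχ_comp, RingHom.congr_fun hcomp_χ⟩

end Acris

end

/-- If `B → B'` is a flat homomorphism of perfect `𝔽_p`-algebras and `C` is a semiperfect
`B`-algebra, then the canonical map `A_cris(C) ⊗̂_{W(B)} W(B') → A_cris(C ⊗_B B')` is an
isomorphism. -/
theorem mainTheorem6 (p : ℕ) [Fact p.Prime] (B B' C : Type*) [CommRing B] [CommRing B']
    [CommRing C] [IsFpAlgebra p B] [IsFpAlgebra p B'] [IsFpAlgebra p C] [PerfectRing B p]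
    [PerfectRing B' p] [IsSemiperfect p C] [Algebra B B'] [Algebra B C] [Module.Flat B B'] :
    Function.Bijective (Acris.baseChangeMap p B B' C) :=
  PCompletion.lift_bijective _ fun _ => Acris.tensorMapMod_bijective
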